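/- Fix a number of classes $c\ge 2$, class sizes $N_1,\dots,N_c\ge 1$ and signal strengths $s_1,\dots,s_c$. For each dimension $d$ let $\sigma=\sigma_d>0$ and $\mu_1,\dots,\mu_c\in\mathbb R^d$ (depending on $d$) be such that, for all sufficiently large $d$, $\sigma^2=1/d$, $\|\mu_i\|^2=s_i/\sqrt d$ and $\langle\mu_i,\mu_j\rangle=0$ for $i\ne j$. A training set $\mathcal D_d$ consists of $N_y$ examples of each class $y$, all independent, those of class $y$ having law $\mathcal N(\mu_y,\sigma^2 I_d)$; let $\bar x_i$ be the sum of the feature vectors of class $i$. For each $d$ let $\tilde\alpha_y=\tilde\alpha_y(d)\in\mathbb R^c$ $(y\in[c])$ and $\tilde b=\tilde b(d)\in\mathbb R^c$ be arbitrary deterministic coefficients, and consider the predictor $\tilde W=(\tilde w_1,\dots,\tilde w_c)$, $\tilde b$ with $\tilde w_y=\sum_{i=1}^c\tilde\alpha_{y[i]}\bar x_i$. For a predictor $(W,b)$ and a fresh test point $x\sim\mathcal N(\mu_y,\sigma^2I_d)$ put $\mathrm{Err}_y(W,b)=\mathbb P_x\big(y\notin\arg\max_i\{\langle w_i,x\rangle+b_{[i]}\}\big)$,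 $\mathrm{Err}_{y\to k}(W,b)=\mathbb P_x\big(\langle w_k,x\rangle+b_{[k]}>\langle w_y,x\rangle+b_{[y]}\big)$ and $\mathrm{WCE}(W,b)=\max_y\mathrm{Err}_y(W,b)$. The score statistics are $\nu^{(y)}_{[j]}=\sigma^{-1}\big(\langle w_y-w_j,\mu_y\rangle+b_{[y]}-b_{[j]}\big)$ and $\Sigma^{(y)}_{[i,j]}=\langle w_y-w_i,w_y-w_j\rangle$; let $\hat\nu^{(y)}$, $\hat\Sigma^{(y)}$ be the expectations over $\mathcal D_d$ of the score statistics of $(\tilde W,\tilde b)$. Let $Q(t)=\mathbb P(\mathcal N(0,1)>t)$ and $\xi_i=\|\mu_i\|^2+\sigma^2d/N_i$. Then the following hold, where convergence in probability is with respect to the random training set $\mathcal D_d$. 1. For every $d$ at which the above scaling holds, the expectations exist and $$\hat\nu^{(y)}_{[i]}=\frac{(\tilde\alpha_{y[y]}-\tilde\alpha_{i[y]})N_y\|\mu_y\|^2+\tilde b_{[y]}-\tilde b_{[i]}}{\sigma},\qquad \hat\Sigma^{(y)}_{[i,j]}=\sum_{z=1}^c(\tilde\alpha_{y[z]}-\tilde\alpha_{i[z]})(\tilde\alpha_{y[z]}-\tilde\alpha_{j[z]})N_z^2\xi_z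 .$$ 2. For every $y$, as $d\to\infty$, $$\mathrm{Err}_y(\tilde W,\tilde b)-\Big(1-\mathbb P\big[\mathcal N(\hat\nu^{(y)},\hat\Sigma^{(y)})\ge0\big]\Big)\longrightarrow0\quad\text{in probability}$$ (with $\ge 0$ coordinatewise). In particular, if $1-\mathbb P[\mathcal N(\hat\nu^{(y)},\hat\Sigma^{(y)})\ge0]$ has a limit as $d\to\infty$, then $\mathrm{Err}_y(\tilde W,\tilde b)$ converges in probability to that limit. Moreover $\mathrm{WCE}(\tilde W,\tilde b)-\max_y\big(1-\mathbb P[\mathcal N(\hat\nu^{(y)},\hat\Sigma^{(y)})\ge0]\big)\to0$ in probability. 3. For $k\ne y$ put $$Q_{y,k}(d)=Q\left(\frac{(\tilde\alpha_{y[y]}-\tilde\alpha_{k[y]})N_y\|\mu_y\|^2+\tilde b_{[y]}-\tilde b_{[k]}}{\sigma\sqrt{\sum_{i=1}^c(\tilde\alpha_{y[i]}-\tilde\alpha_{k[i]})^2N_i^2\xi_i}}\right).$$ If $\tilde\alpha_y\ne\tilde\alpha_k$ for all large $d$, then $\mathrm{Err}_{y\to k}(\tilde W,\tilde b)-Q_{y,k}(d)\to0$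 in probability. 4. If for every pair $k\ne y$ one has $\tilde\alpha_y\neq\tilde\alpha_k$ for all large $d$, then for every $\varepsilon>0$ the probability that $\mathrm{WCE}(\tilde W,\tilde b)<\max_{y,\,k\ne y}Q_{y,k}(d)-\varepsilon$ tends to $0$. In particular, if the limits $\lim_{d\to\infty}Q_{y,k}(d)$ exist for all $k\ne y$, then $\mathrm{Err}_{y\to k}(\tilde W,\tilde b)$ converges in probability to $\lim_{d\to\infty} Q_{y,k}(d)$ for all $k\neq y$, and, whenever $\mathrm{WCE}(\tilde W,\tilde b)$ converges in probability to a constant $\lim_{d\to\infty}\mathrm{WCE}$, $$\max_{y,\,k\ne y}\ \lim_{d\to\infty}Q_{y,k}(d)=\max_{y,\,k\ne y}\ \lim_{d\to\infty}\mathrm{Err}_{y\to k}(\tilde W,\tilde b)\ \le\ \lim_{d\to\infty}\mathrm{WCE}(\tilde W,\tilde b).$$ -/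

import Mathlib

open MeasureTheory ProbabilityTheory Filter Topology

noncomputable section

namespace ImbalancedMixture

/-! ### Linear predictors, errors -/

/-- The score vector `z = Wᵀ x + b`; the `k`-th column of `W` is `W k`. -/
def scores {c d : ℕ} (W : Fin c → EuclideanSpace ℝ (Fin d)) (b : Fin c → ℝ)
    (x : EuclideanSpace ℝ (Fin d)) (k : Fin c) : ℝ :=
  inner ℝ (W k) x + b k

open Classical in
/-- The 0-1 loss: `1` if `y` is not in the argmax set of `z`, and `0` otherwise. -/
def zeroOneLoss {c : ℕ} (z : Fin c → ℝ) (y : Fin c) : ℝ :=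
  if y ∈ {i | ∀ j, z j ≤ z i} then 0 else 1

/-- The class-conditional distribution `N(m, σ² I_d)`. -/
def classLaw {d : ℕ} (σ : ℝ) (m : EuclideanSpace ℝ (Fin d)) :
    Measure (EuclideanSpace ℝ (Fin d)) :=
  multivariateGaussian m (σ ^ 2 • (1 : Matrix (Fin d) (Fin d) ℝ))

/-- `Err_y(W, b)`: expected 0-1 loss on a test point `x | y ∼ N(μ_y, σ² I)`. -/
def err {c d : ℕ} (σ : ℝ) (μ : Fin c → EuclideanSpace ℝ (Fin d))
    (W : Fin c → EuclideanSpace ℝ (Fin d)) (b : Fin c → ℝ) (y : Fin c) : ℝ :=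
  ∫ x, zeroOneLoss (scores W b x) y ∂(classLaw σ (μ y))

/-- `Err_{y→k}(W, b)`: probability that class `k` scores strictly higher than the true class. -/
def errTo {c d : ℕ} (σ : ℝ) (μ : Fin c → EuclideanSpace ℝ (Fin d))
    (W : Fin c → EuclideanSpace ℝ (Fin d)) (b : Fin c → ℝ) (y k : Fin c) : ℝ :=
  (classLaw σ (μ y)).real {x | scores W b x k > scores W b x y}

/-- The worst class error `max_y Err_y(W, b)` (a maximum over a finite set). -/
def worstClassErr {c d : ℕ} (σ : ℝ) (μ : Fin c → EuclideanSpace ℝ (Fin d))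
    (W : Fin c → EuclideanSpace ℝ (Fin d)) (b : Fin c → ℝ) : ℝ :=
  ⨆ y, err σ μ W b y

/-! ### Training data -/

/-- A training set with `N k` feature vectors of class `k`. -/
abbrev Dataset {c : ℕ} (d : ℕ) (N : Fin c → ℕ) : Type :=
  (k : Fin c) → Fin (N k) → EuclideanSpace ℝ (Fin d)

/-- Law of the training set: all examples independent, those of class `k` with law
`N(μ_k, σ² I)`. -/
def trainLaw {c d : ℕ} (N : Fin c → ℕ) (σ : ℝ) (μ : Fin c → EuclideanSpace ℝ (Fin d)) :
    Measure (Dataset d N) :=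
  Measure.pi fun k => Measure.pi fun _ : Fin (N k) => classLaw σ (μ k)

/-- The scaling of the model parameters in dimension `d`, with signal strengths `s`. -/
structure ModelScaling {c : ℕ} (d : ℕ) (s : Fin c → ℝ) (σ : ℝ)
    (μ : Fin c → EuclideanSpace ℝ (Fin d)) : Prop where
  sigma_pos : 0 < σ
  sigma_sq : σ ^ 2 = 1 / (d : ℝ)
  norm_sq : ∀ i, ‖μ i‖ ^ 2 = s i / √(d : ℝ)
  orthogonal : ∀ i j, i ≠ j → inner ℝ (μ i) (μ j) = 0

/-- The sum `x̄_i` of the feature vectors of class `i`. -/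
def classSum {c d : ℕ} {N : Fin c → ℕ} (X : Dataset d N) (i : Fin c) :
    EuclideanSpace ℝ (Fin d) :=
  ∑ j, X i j

/-- The predictor `w̃_y = ∑ i, α_y[i] x̄_i`. -/
def weights {c d : ℕ} {N : Fin c → ℕ} (α : Fin c → Fin c → ℝ) (X : Dataset d N) (y : Fin c) :
    EuclideanSpace ℝ (Fin d) :=
  ∑ i, α y i • classSum X i

/-! ### Score statistics -/

/-- The score mean `ν^{(y)}` of a predictor. -/
def scoreMean {c d : ℕ} (σ : ℝ) (μ : Fin c → EuclideanSpace ℝ (Fin d))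
    (W : Fin c → EuclideanSpace ℝ (Fin d)) (b : Fin c → ℝ) (y j : Fin c) : ℝ :=
  (inner ℝ (W y - W j) (μ y) + b y - b j) / σ

/-- The score covariance `Σ^{(y)}` of a predictor. -/
def scoreCov {c d : ℕ} (W : Fin c → EuclideanSpace ℝ (Fin d)) (y i j : Fin c) : ℝ :=
  inner ℝ (W y - W i) (W y - W j)

/-- `ν̂^{(y)}`: expectation over the training data of the score mean of the predictor with
coefficients `α`, `b`. -/
def expScoreMean {c d : ℕ} (N : Fin c → ℕ) (σ : ℝ) (μ : Fin c → EuclideanSpace ℝ (Fin d))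
    (α : Fin c → Fin c → ℝ) (b : Fin c → ℝ) (y : Fin c) : EuclideanSpace ℝ (Fin c) :=
  WithLp.toLp 2 fun i => ∫ X : Dataset d N, scoreMean σ μ (weights α X) b y i ∂(trainLaw N σ μ)

/-- `Σ̂^{(y)}`: expectation over the training data of the score covariance of the predictor with
coefficients `α`. -/
def expScoreCov {c d : ℕ} (N : Fin c → ℕ) (σ : ℝ) (μ : Fin c → EuclideanSpace ℝ (Fin d))
    (α : Fin c → Fin c → ℝ) (y : Fin c) : Matrix (Fin c) (Fin c) ℝ :=
  Matrix.of fun i j => ∫ X : Dataset d N, scoreCov (weights α X) y i j ∂(trainLaw N σ μ)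

/-- `ξ_i = ‖μ_i‖² + σ² d / N_i`. -/
def xi {c d : ℕ} (N : Fin c → ℕ) (σ : ℝ) (μ : Fin c → EuclideanSpace ℝ (Fin d)) (i : Fin c) : ℝ :=
  ‖μ i‖ ^ 2 + σ ^ 2 * d / N i

/-- `1 - P(N(ν̂^{(y)}, Σ̂^{(y)}) ≥ 0)`, the inequality being coordinatewise. -/
def approxErr {c d : ℕ} (N : Fin c → ℕ) (σ : ℝ) (μ : Fin c → EuclideanSpace ℝ (Fin d))
    (α : Fin c → Fin c → ℝ) (b : Fin c → ℝ) (y : Fin c) : ℝ :=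
  1 - (multivariateGaussian (expScoreMean N σ μ α b y) (expScoreCov N σ μ α y)).real
    {v | ∀ i, 0 ≤ v i}

/-- The Gaussian tail function `Q(t) = P(N(0,1) > t)`. -/
def gaussianQ (t : ℝ) : ℝ := (gaussianReal 0 1).real (Set.Ioi t)

/-- The `Q`-function term of the pair `y`, `k`. -/
def approxErrTo {c d : ℕ} (N : Fin c → ℕ) (σ : ℝ) (μ : Fin c → EuclideanSpace ℝ (Fin d))
    (α : Fin c → Fin c → ℝ) (b : Fin c → ℝ) (y k : Fin c) : ℝ :=
  gaussianQ (((α y y - α k y) * N y * ‖μ y‖ ^ 2 + b y - b k) /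
    (σ * √(∑ i, (α y i - α k i) ^ 2 * (N i : ℝ) ^ 2 * xi N σ μ i)))

/-- The maximum of `f y k` over all pairs of distinct classes `k ≠ y`. -/
def maxPairs {c : ℕ} (f : Fin c → Fin c → ℝ) : ℝ :=
  ⨆ p : {p : Fin c × Fin c // p.2 ≠ p.1}, f p.1.1 p.1.2

/-! ### Convergence in probability along a sequence of probability spaces -/

/-- `F d - a d → 0` in probability, where `F d` lives on the probability space `(Ω d, P d)` and
`a d` is deterministic. For constant `a` this is convergence in probability to a constant. -/
def TendstoInProb {Ω : ℕ → Type} [∀ d, MeasurableSpace (Ω d)] (P : ∀ d, Measure (Ω d))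
    (F : ∀ d, Ω d → ℝ) (a : ℕ → ℝ) : Prop :=
  ∀ ε : ℝ, 0 < ε → Tendsto (fun d => P d {ω | ε ≤ |F d ω - a d|}) atTop (𝓝 0)

end ImbalancedMixture

end

open ImbalancedMixture

/-! Given the training set, the scaled score gaps of a test point of class `y` are Gaussian. Their
law is the image of `N(t, G)` under an affine map determined by the coefficients `(α, b)`, where `t`
collects the scaled scores of the class sums at `μ_y` and `G` is the Gram matrix of the class sums.
By Chebyshev's inequality `(t, G)` converges in probability, to the same limit as its expectation.
The limit of `G` is positive definite, so Scheffé's lemma upgrades this to convergence of `N(t, G)`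
in total variation: uniformity over all measurable sets absorbs the arbitrary dependence of `(α, b)`
on the dimension. The pairwise errors are one-dimensional marginals of the same Gaussian, and the
worst-class error dominates each of them. -/

namespace ImbalancedMixture

open Matrix WithLp

/-! ### Convergence in probability as convergence along a filter -/

section ProbFilter

variable {ι : Type*} {Ω : ι → Type*} [∀ i, MeasurableSpace (Ω i)]

/-- The filter of the events in `Σ i, Ω i` whose probability tends to one along `l`. Convergence
along it is convergence in probability, to which the general theory of limits thereby applies. -/
def probFilter (l : Filter ι) (P : ∀ i, Measure (Ω i)) : Filter (Σ i, Ω i) :=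
  comk (fun A => Tendsto (fun i => P i (Sigma.mk i ⁻¹' A)) l (𝓝 0))
    (by simp [tendsto_const_nhds])
    (fun _ hB _ hAB => tendsto_of_tendsto_of_tendsto_of_le_of_le tendsto_const_nhds hB
      (fun _ => zero_le) fun _ => measure_mono (Set.preimage_mono hAB))
    fun A hA B hB => tendsto_of_tendsto_of_tendsto_of_le_of_le tendsto_const_nhds
      (add_zero (0 : ENNReal) ▸ hA.add hB) (fun _ => zero_le) fun _ => measure_union_le _ _

variable {l : Filter ι} {P : ∀ i, Measure (Ω i)}

theorem eventually_probFilter {p : (Σ i, Ω i) → Prop} :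
    (∀ᶠ x in probFilter l P, p x) ↔ Tendsto (fun i => P i {ω | ¬ p ⟨i, ω⟩}) l (𝓝 0) :=
  Iff.rfl

theorem tendsto_fst_probFilter : Tendsto Sigma.fst (probFilter l P) l := by
  refine tendsto_def.2 fun A hA => eventually_probFilter.2 (tendsto_const_nhds.congr' ?_)
  filter_upwards [hA] with i hi
  simp [hi]

theorem probFilter_neBot [l.NeBot] [∀ i, IsProbabilityMeasure (P i)] : (probFilter l P).NeBot := by
  refine neBot_iff.2 fun h => one_ne_zero (α := ENNReal) ?_
  have h_zero : ∀ᶠ _ in probFilter l P, False := h ▸ eventually_bot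
  exact tendsto_nhds_unique (by simp) (eventually_probFilter.1 h_zero)

theorem tendsto_probFilter_of_tendsto_variance [∀ i, IsFiniteMeasure (P i)] {F : ∀ i, Ω i → ℝ}
    {a : ℝ} (hF : ∀ᶠ i in l, MemLp (F i) 2 (P i))
    (hmean : Tendsto (fun i => ∫ ω, F i ω ∂P i) l (𝓝 a))
    (hvar : Tendsto (fun i => Var[F i; P i]) l (𝓝 0)) :
    Tendsto (fun x : Σ i, Ω i => F x.1 x.2) (probFilter l P) (𝓝 a) := by
  suffices Tendsto (fun x : Σ i, Ω i => F x.1 x.2 - ∫ ω, F x.1 ω ∂P x.1) (probFilter l P) (𝓝 0) by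
    simpa using this.add (hmean.comp tendsto_fst_probFilter)
  refine Metric.tendsto_nhds.2 fun ε hε => eventually_probFilter.2 ?_
  have hbound : Tendsto (fun i => ENNReal.ofReal (Var[F i; P i] / ε ^ 2)) l (𝓝 0) := by
    simpa using ENNReal.tendsto_ofReal (hvar.div_const (ε ^ 2))
  refine tendsto_of_tendsto_of_tendsto_of_le_of_le' tendsto_const_nhds hbound
    (.of_forall fun _ => zero_le) ?_
  filter_upwards [hF] with i hi
  simpa using meas_ge_le_variance_div_sq hi hε

end ProbFilter

theorem abs_iSup_sub_iSup_le {κ : Type*} [Finite κ] {f g : κ → ℝ} {ε : ℝ} (hε : 0 ≤ ε)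
    (h : ∀ k, |f k - g k| ≤ ε) : |(⨆ k, f k) - ⨆ k, g k| ≤ ε := by
  rcases isEmpty_or_nonempty κ with _ | _
  · simpa using hε
  have iSup_le_add {f g : κ → ℝ} (h : ∀ k, f k ≤ g k + ε) : ⨆ k, f k ≤ (⨆ k, g k) + ε :=
    ciSup_le fun k => (h k).trans (by gcongr; exact le_ciSup (Set.finite_range g).bddAbove k)
  have h₁ := iSup_le_add (f := f) (g := g) fun k => by linarith [(abs_le.1 (h k)).2]
  have h₂ := iSup_le_add (f := g) (g := f) fun k => by linarith [(abs_le.1 (h k)).1]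
  exact abs_le.2 ⟨by linarith, by linarith⟩

namespace TendstoInProb

variable {Ω : ℕ → Type} [∀ d, MeasurableSpace (Ω d)] {P : ∀ d, Measure (Ω d)}
  {F G : ∀ d, Ω d → ℝ} {a : ℕ → ℝ}

theorem iff_tendsto_sub :
    TendstoInProb P F a ↔
      Tendsto (fun x : Σ d, Ω d => F x.1 x.2 - a x.1) (probFilter atTop P) (𝓝 0) := by
  simp [TendstoInProb, Metric.tendsto_nhds, eventually_probFilter]

theorem iff_tendsto {l : ℝ} :
    TendstoInProb P F (fun _ => l) ↔
      Tendsto (fun x : Σ d, Ω d => F x.1 x.2) (probFilter atTop P) (𝓝 l) := by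
  rw [iff_tendsto_sub, tendsto_sub_nhds_zero_iff]

theorem const_of_tendsto {l : ℝ} (h : TendstoInProb P F a) (ha : Tendsto a atTop (𝓝 l)) :
    TendstoInProb P F fun _ => l := by
  have hsum := (iff_tendsto_sub.1 h).add (ha.comp tendsto_fst_probFilter)
  exact iff_tendsto.2 (by simpa using hsum)

theorem iSup {κ : Type*} [Finite κ] {F : κ → ∀ d, Ω d → ℝ} {a : κ → ℕ → ℝ}
    (h : ∀ k, TendstoInProb P (F k) (a k)) :
    TendstoInProb P (fun d ω => ⨆ k, F k d ω) (fun d => ⨆ k, a k d) := by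
  refine iff_tendsto_sub.2 (Metric.tendsto_nhds.2 fun ε hε => ?_)
  have hclose (k : κ) := Metric.tendsto_nhds.1 (iff_tendsto_sub.1 (h k)) (ε / 2) (half_pos hε)
  filter_upwards [eventually_all.2 hclose] with x hx
  rw [dist_zero_right, Real.norm_eq_abs]
  refine (abs_iSup_sub_iSup_le (half_pos hε).le fun k => ?_).trans_lt (half_lt_self hε)
  simpa using (hx k).le

theorem maxPairs {c : ℕ} {F : Fin c → Fin c → ∀ d, Ω d → ℝ} {a : Fin c → Fin c → ℕ → ℝ}
    (h : ∀ y k, k ≠ y → TendstoInProb P (F y k) (a y k)) :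
    TendstoInProb P (fun d ω => maxPairs fun y k => F y k d ω)
      (fun d => maxPairs fun y k => a y k d) :=
  .iSup fun p : {p : Fin c × Fin c // p.2 ≠ p.1} => h p.1.1 p.1.2 p.2

theorem tendsto_measure_lt_sub (h : TendstoInProb P F a) (hFG : ∀ d ω, F d ω ≤ G d ω) {ε : ℝ}
    (hε : 0 < ε) : Tendsto (fun d => P d {ω | G d ω < a d - ε}) atTop (𝓝 0) := by
  refine tendsto_of_tendsto_of_tendsto_of_le_of_le tendsto_const_nhds (h ε hε)
    (fun _ => zero_le) fun d => measure_mono fun ω (hω : G d ω < a d - ε) => ?_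
  have : ε ≤ -(F d ω - a d) := by linarith [hFG d ω]
  exact this.trans (neg_le_abs _)

theorem le_of_le [∀ d, IsProbabilityMeasure (P d)] {l l' : ℝ}
    (hF : TendstoInProb P F fun _ => l) (hG : TendstoInProb P G fun _ => l')
    (hFG : ∀ d ω, F d ω ≤ G d ω) : l ≤ l' :=
  have := probFilter_neBot (l := atTop) (P := P)
  le_of_tendsto_of_tendsto' (iff_tendsto.1 hF) (iff_tendsto.1 hG) fun _ => hFG _ _

end TendstoInProb

/-! ### Total variation continuity of Gaussian measures -/

section Scheffe

variable {ι X : Type*} [MeasurableSpace X] {ν : Measure X} {l : Filter ι} {f : ι → X → ℝ}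
  {g : X → ℝ}

/- Scheffé's lemma: `|f - g| = f + g - 2 min f g`, and `min f g` is dominated by `g`. -/
theorem tendsto_integral_abs_sub_of_tendsto_integral [l.IsCountablyGenerated]
    (hf : ∀ᶠ i in l, Integrable (f i) ν) (hf_nonneg : ∀ᶠ i in l, 0 ≤ f i) (hg : Integrable g ν)
    (hint : Tendsto (fun i => ∫ x, f i x ∂ν) l (𝓝 (∫ x, g x ∂ν)))
    (hlim : ∀ x, Tendsto (fun i => f i x) l (𝓝 (g x))) :
    Tendsto (fun i => ∫ x, |f i x - g x| ∂ν) l (𝓝 0) := by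
  rcases l.eq_or_neBot with rfl | _
  · exact tendsto_bot
  have hg_nonneg (x : X) : 0 ≤ g x :=
    ge_of_tendsto (hlim x) (hf_nonneg.mono fun _ hi => hi x)
  have hmin : Tendsto (fun i => ∫ x, min (f i x) (g x) ∂ν) l (𝓝 (∫ x, g x ∂ν)) := by
    refine tendsto_integral_filter_of_dominated_convergence g ?_ ?_ hg (.of_forall fun x => ?_)
    · filter_upwards [hf] with i hi using hi.1.inf hg.1
    · filter_upwards [hf_nonneg] with i hi
      refine .of_forall fun x => ?_
      rw [Real.norm_of_nonneg (le_min (hi x) (hg_nonneg x))]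
      exact min_le_right _ _
    · simpa using (hlim x).min (tendsto_const_nhds (x := g x))
  have hsum := (hint.add_const (∫ x, g x ∂ν)).sub (hmin.const_mul 2)
  rw [two_mul, sub_self] at hsum
  refine hsum.congr' ?_
  filter_upwards [hf] with i hi
  have h_abs (x : X) : |f i x - g x| = f i x + g x - 2 * min (f i x) (g x) := by
    linarith [max_sub_min_eq_abs' (f i x) (g x), max_add_min (f i x) (g x)]
  have h_add : Integrable (fun x => f i x + g x) ν := hi.add hg
  have h_min : Integrable (fun x => 2 * min (f i x) (g x)) ν := (hi.inf hg).const_mul 2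
  simp_rw [h_abs]
  rw [integral_sub h_add h_min, integral_add hi hg, integral_const_mul]

theorem tendstoUniformly_setIntegral_of_tendsto_integral_abs_sub
    (hf : ∀ᶠ i in l, Integrable (f i) ν) (hg : Integrable g ν)
    (hlim : Tendsto (fun i => ∫ x, |f i x - g x| ∂ν) l (𝓝 0)) :
    TendstoUniformly (fun i A => ∫ x in A, f i x ∂ν) (fun A => ∫ x in A, g x ∂ν) l := by
  refine Metric.tendstoUniformly_iff.2 fun ε hε => ?_
  filter_upwards [hf, hlim.eventually_lt_const hε] with i hi hlt A
  rw [dist_comm, Real.dist_eq, ← integral_sub hi.integrableOn hg.integrableOn]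
  calc |∫ x in A, (f i x - g x) ∂ν|
      ≤ ∫ x in A, |f i x - g x| ∂ν := abs_integral_le_integral_abs
    _ ≤ ∫ x, |f i x - g x| ∂ν :=
      setIntegral_le_integral (hi.sub hg).abs (.of_forall fun _ => abs_nonneg _)
    _ < ε := hlt

end Scheffe

section Density

variable {E : Type*} [NormedAddCommGroup E] [InnerProductSpace ℝ E] [FiniteDimensional ℝ E]
  [MeasurableSpace E] [BorelSpace E]

theorem integrable_exp_neg_norm_sq_div_two :
    Integrable fun x : E => Real.exp (-(‖x‖ ^ 2 / 2)) := by
  have h := (GaussianFourier.integrable_cexp_neg_mul_sq_norm_add (V := E) (b := 1 / 2)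
    (by norm_num) 0 0).norm
  refine h.congr (.of_forall fun x => ?_)
  have hexp : -(1 / 2 : ℂ) * ‖x‖ ^ 2 + 0 * (inner ℝ 0 x : ℝ) = ((-(‖x‖ ^ 2 / 2) : ℝ) : ℂ) := by
    push_cast
    ring
  simp only [hexp, Complex.norm_exp, Complex.ofReal_re]

theorem integral_exp_neg_norm_sq_div_two_mul_cexp_inner (t : E) :
    ∫ x : E, (Real.exp (-(‖x‖ ^ 2 / 2)) : ℂ) * Complex.exp (inner ℝ x t * Complex.I) =
      ((2 * Real.pi) ^ (Module.finrank ℝ E / 2 : ℝ) : ℝ) * Complex.exp (-‖t‖ ^ 2 / 2) := by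
  have h := GaussianFourier.integral_cexp_neg_mul_sq_norm_add (V := E) (b := 1 / 2) (by norm_num)
    Complex.I t
  rw [Complex.ofReal_cpow (by positivity)]
  convert h using 2
  · ext x
    rw [Complex.ofReal_exp, ← Complex.exp_add, real_inner_comm]
    push_cast
    ring_nf
  · push_cast
    ring_nf
  · rw [Complex.I_sq]
    ring_nf

/-- The standard Gaussian density of a Euclidean space. -/
noncomputable def stdGaussianDensity (x : E) : ℝ :=
  (2 * Real.pi) ^ (-(Module.finrank ℝ E / 2 : ℝ)) * Real.exp (-(‖x‖ ^ 2 / 2))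

theorem stdGaussian_eq_withDensity :
    stdGaussian E = volume.withDensity fun x => ENNReal.ofReal (stdGaussianDensity x) := by
  have h_int : Integrable (stdGaussianDensity (E := E)) :=
    integrable_exp_neg_norm_sq_div_two.const_mul _
  have := isFiniteMeasure_withDensity_ofReal h_int.2
  refine Measure.ext_of_charFun (funext fun t => ?_)
  have h_nonneg (x : E) : 0 ≤ stdGaussianDensity x := by unfold stdGaussianDensity; positivity
  rw [charFun_stdGaussian, charFun_apply, integral_withDensity_eq_integral_toReal_smul₀
    h_int.1.aemeasurable.ennreal_ofReal (by simp)]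
  simp_rw [ENNReal.toReal_ofReal (h_nonneg _), Complex.real_smul, stdGaussianDensity,
    Complex.ofReal_mul, mul_assoc]
  rw [integral_const_mul, integral_exp_neg_norm_sq_div_two_mul_cexp_inner, ← mul_assoc,
    ← Complex.ofReal_mul, ← Real.rpow_add (by positivity)]
  simp

theorem map_add_clm_withDensity {ν : Measure E} [ν.IsAddHaarMeasure] {L : E →L[ℝ] E}
    (hL : L.det ≠ 0) (m : E) {f : E → ENNReal} (hf : Measurable f) :
    (ν.withDensity fun x => ENNReal.ofReal |L.det| * f (m + L x)).map (fun x => m + L x) =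
      ν.withDensity f := by
  have hmeas : Measurable fun x : E => m + L x := by fun_prop
  have hmap : ν.map (fun x => m + L x) = ENNReal.ofReal |L.det|⁻¹ • ν := by
    have h := Measure.map_linearMap_addHaar_eq_smul_addHaar ν (f := (L : E →ₗ[ℝ] E)) hL
    rw [ContinuousLinearMap.coe_coe] at h
    rw [← Function.comp_def (m + ·) L, ← Measure.map_map (by fun_prop) (by fun_prop), h,
      Measure.map_smul, map_add_left_eq_self, ← abs_inv]
  ext A hA
  rw [Measure.map_apply hmeas hA, withDensity_apply _ (hmeas hA), withDensity_apply _ hA,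
    lintegral_const_mul _ (by fun_prop), ← setLIntegral_map hA hf hmeas, hmap,
    Measure.restrict_smul, lintegral_smul_measure, smul_eq_mul, ← mul_assoc,
    ← ENNReal.ofReal_mul (abs_nonneg _), mul_inv_cancel₀ (abs_ne_zero.2 hL), ENNReal.ofReal_one,
    one_mul]

end Density

section MultivariateGaussian

variable {ι : Type*} [Fintype ι] [DecidableEq ι]

/-- The density of `N(m, S)` with respect to the Lebesgue measure, for positive definite `S`. -/
noncomputable def gaussianDensity (m : EuclideanSpace ℝ ι) (S : Matrix ι ι ℝ)
    (x : EuclideanSpace ℝ ι) : ℝ :=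
  (2 * Real.pi) ^ (-(Fintype.card ι / 2 : ℝ)) * (√S.det)⁻¹ *
    Real.exp (-((ofLp x - ofLp m) ⬝ᵥ S⁻¹ *ᵥ (ofLp x - ofLp m) / 2))

theorem gaussianDensity_nonneg (m : EuclideanSpace ℝ ι) (S : Matrix ι ι ℝ) :
    0 ≤ gaussianDensity m S := by
  intro x
  unfold gaussianDensity
  positivity

theorem continuous_gaussianDensity (m : EuclideanSpace ℝ ι) (S : Matrix ι ι ℝ) :
    Continuous (gaussianDensity m S) := by
  unfold gaussianDensity
  fun_prop

theorem abs_det_mul_gaussianDensity {A : Matrix ι ι ℝ} (hA : A.IsSymm) (hdet : A.det ≠ 0)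
    (m x : EuclideanSpace ℝ ι) :
    |A.det| * gaussianDensity m (A * A) (m + toEuclideanCLM (𝕜 := ℝ) A x) =
      stdGaussianDensity x := by
  have hquad : A *ᵥ ofLp x ⬝ᵥ (A * A)⁻¹ *ᵥ A *ᵥ ofLp x = ‖x‖ ^ 2 := by
    have hinv : A * (A * A)⁻¹ * A = 1 := by
      rw [Matrix.mul_inv_rev, ← mul_assoc, mul_nonsing_inv _ hdet.isUnit, one_mul,
        nonsing_inv_mul _ hdet.isUnit]
    nth_rewrite 1 [← hA.eq]
    rw [mulVec_transpose, ← dotProduct_mulVec, mulVec_mulVec, mulVec_mulVec, hinv, one_mulVec,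
      EuclideanSpace.real_norm_sq_eq]
    simp [dotProduct, sq]
  have hsub : ofLp (m + toEuclideanCLM (𝕜 := ℝ) A x) - ofLp m = A *ᵥ ofLp x := by simp
  rw [gaussianDensity, hsub, hquad, det_mul, Real.sqrt_mul_self_eq_abs, stdGaussianDensity,
    finrank_euclideanSpace]
  field_simp [abs_ne_zero.2 hdet]

open scoped MatrixOrder in
theorem multivariateGaussian_eq_withDensity (m : EuclideanSpace ℝ ι) {S : Matrix ι ι ℝ}
    (hS : S.PosDef) :
    multivariateGaussian m S =
      volume.withDensity fun x => ENNReal.ofReal (gaussianDensity m S x) := by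
  set A : Matrix ι ι ℝ := CFC.sqrt S with hA
  have hAA : A * A = S := CFC.sqrt_mul_sqrt_self _ hS.posSemidef.nonneg
  have hsymm : Aᵀ = A := by
    simpa [star_eq_conjTranspose] using (CFC.sqrt_nonneg S).isSelfAdjoint.star_eq
  have hdet : A.det ≠ 0 := by
    have := hS.det_pos
    rw [← hAA, det_mul] at this
    exact left_ne_zero_of_mul this.ne'
  have hLdet : (toEuclideanCLM (n := ι) (𝕜 := ℝ) A).det = A.det := by
    rw [ContinuousLinearMap.det, coe_toEuclideanCLM_eq_toEuclideanLin,
      toEuclideanLin_eq_toLin_orthonormal, LinearMap.det_toLin]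
  rw [multivariateGaussian, ← hA, stdGaussian_eq_withDensity, ← map_add_clm_withDensity
    (hLdet.symm ▸ hdet) m (continuous_gaussianDensity m S).measurable.ennreal_ofReal]
  simp_rw [hLdet, ← ENNReal.ofReal_mul (abs_nonneg _), ← hAA,
    abs_det_mul_gaussianDensity hsymm hdet]

theorem integrable_gaussianDensity (m : EuclideanSpace ℝ ι) {S : Matrix ι ι ℝ} (hS : S.PosDef) :
    Integrable (gaussianDensity m S) := by
  refine ⟨(continuous_gaussianDensity m S).aestronglyMeasurable, ?_⟩
  rw [hasFiniteIntegral_iff_ofReal (.of_forall (gaussianDensity_nonneg m S)),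
    ← setLIntegral_univ, ← withDensity_apply _ .univ, ← multivariateGaussian_eq_withDensity m hS]
  exact measure_lt_top _ _

theorem multivariateGaussian_real_apply (m : EuclideanSpace ℝ ι) {S : Matrix ι ι ℝ}
    (hS : S.PosDef) {A : Set (EuclideanSpace ℝ ι)} (hA : MeasurableSet A) :
    (multivariateGaussian m S).real A = ∫ x in A, gaussianDensity m S x := by
  rw [measureReal_def, multivariateGaussian_eq_withDensity m hS, withDensity_apply _ hA,
    integral_eq_lintegral_of_nonneg_ae (.of_forall (gaussianDensity_nonneg m S))
      (continuous_gaussianDensity m S).aestronglyMeasurable]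

theorem continuousAt_gaussianDensity (m₀ : EuclideanSpace ℝ ι) {S₀ : Matrix ι ι ℝ}
    (hS₀ : S₀.PosDef) (x : EuclideanSpace ℝ ι) :
    ContinuousAt (fun p : EuclideanSpace ℝ ι × Matrix ι ι ℝ => gaussianDensity p.1 p.2 x)
      (m₀, S₀) := by
  have hinv : ContinuousAt (fun p : EuclideanSpace ℝ ι × Matrix ι ι ℝ => p.2⁻¹) (m₀, S₀) := by
    refine ContinuousAt.comp' (g := Inv.inv) (continuousAt_matrix_inv S₀ ?_) continuousAt_snd
    rw [Ring.inverse_eq_inv']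
    exact continuousAt_inv₀ hS₀.det_pos.ne'
  have hquad : Continuous fun q : (ι → ℝ) × Matrix ι ι ℝ => q.1 ⬝ᵥ q.2 *ᵥ q.1 / 2 := by
    fun_prop
  have hpair : ContinuousAt (fun p : EuclideanSpace ℝ ι × Matrix ι ι ℝ =>
      ((ofLp x - ofLp p.1, p.2⁻¹) : (ι → ℝ) × Matrix ι ι ℝ)) (m₀, S₀) :=
    ContinuousAt.prodMk (by fun_prop) hinv
  have hdet : ContinuousAt (fun p : EuclideanSpace ℝ ι × Matrix ι ι ℝ => (√p.2.det)⁻¹)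
      (m₀, S₀) :=
    ContinuousAt.inv₀ (by fun_prop) (Real.sqrt_pos.2 hS₀.det_pos).ne'
  exact (continuousAt_const.mul hdet).mul
    (Real.continuous_exp.continuousAt.comp (hquad.continuousAt.comp hpair).neg)

theorem eventually_posDef_of_posSemidef {κ : Type*} [Finite κ] {S₀ : Matrix κ κ ℝ}
    (hS₀ : S₀.PosDef) : ∀ᶠ S in 𝓝 S₀, S.PosSemidef → S.PosDef := by
  classical
  have := Fintype.ofFinite κ
  have hdet : ContinuousAt (det : Matrix κ κ ℝ → ℝ) S₀ := by fun_prop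
  filter_upwards [hdet.eventually_ne hS₀.det_pos.ne'] with S hS hpsd
  exact hpsd.posDef_iff_isUnit.2 ((isUnit_iff_isUnit_det S).2 hS.isUnit)

theorem tendstoUniformlyOn_multivariateGaussian (m₀ : EuclideanSpace ℝ ι) {S₀ : Matrix ι ι ℝ}
    (hS₀ : S₀.PosDef) :
    TendstoUniformlyOn
      (fun p : EuclideanSpace ℝ ι × Matrix ι ι ℝ => (multivariateGaussian p.1 p.2).real)
      (multivariateGaussian m₀ S₀).real (𝓝[{p | p.2.PosSemidef}] (m₀, S₀))
      {A | MeasurableSet A} := by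
  have : FirstCountableTopology (Matrix ι ι ℝ) :=
    inferInstanceAs (FirstCountableTopology (ι → ι → ℝ))
  have h_posDef : ∀ᶠ p : EuclideanSpace ℝ ι × Matrix ι ι ℝ in 𝓝[{p | p.2.PosSemidef}] (m₀, S₀),
      p.2.PosDef := by
    have h := (continuous_snd.tendsto (m₀, S₀)).eventually (eventually_posDef_of_posSemidef hS₀)
    filter_upwards [h.filter_mono nhdsWithin_le_nhds, self_mem_nhdsWithin] with p hp hpsd
      using hp hpsd
  have h_int := h_posDef.mono fun p hp => integrable_gaussianDensity p.1 hp
  have h_total (m : EuclideanSpace ℝ ι) {S : Matrix ι ι ℝ} (hS : S.PosDef) :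
      ∫ x, gaussianDensity m S x = 1 := by
    rw [← setIntegral_univ, ← multivariateGaussian_real_apply m hS .univ, probReal_univ]
  have h_L1 := tendsto_integral_abs_sub_of_tendsto_integral h_int
    (.of_forall fun p => gaussianDensity_nonneg p.1 p.2) (integrable_gaussianDensity m₀ hS₀)
    (tendsto_const_nhds.congr' (h_posDef.mono fun p hp =>
      (h_total _ hS₀).trans (h_total _ hp).symm))
    fun x => (continuousAt_gaussianDensity m₀ hS₀ x).tendsto.mono_left nhdsWithin_le_nhds
  refine (((tendstoUniformly_setIntegral_of_tendsto_integral_abs_sub h_int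
    (integrable_gaussianDensity m₀ hS₀) h_L1).tendstoUniformlyOn
      (s := {A | MeasurableSet A})).congr ?_).congr_right fun A hA => ?_
  · filter_upwards [h_posDef] with p hp A hA
      using (multivariateGaussian_real_apply p.1 hp hA).symm
  · exact (multivariateGaussian_real_apply m₀ hS₀ hA).symm

theorem tendstoUniformlyOn_multivariateGaussian_sub {m₀ : EuclideanSpace ℝ ι} {S₀ : Matrix ι ι ℝ}
    (hS₀ : S₀.PosDef) {β : Type*} {l : Filter β} {m m' : β → EuclideanSpace ℝ ι}
    {S S' : β → Matrix ι ι ℝ} (hm : Tendsto m l (𝓝 m₀)) (hS : Tendsto S l (𝓝 S₀))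
    (hS_psd : ∀ᶠ x in l, (S x).PosSemidef) (hm' : Tendsto m' l (𝓝 m₀))
    (hS' : Tendsto S' l (𝓝 S₀)) (hS'_psd : ∀ᶠ x in l, (S' x).PosSemidef) :
    TendstoUniformlyOn (fun x A => (multivariateGaussian (m x) (S x)).real A -
      (multivariateGaussian (m' x) (S' x)).real A) 0 l {A | MeasurableSet A} := by
  have comp {m : β → EuclideanSpace ℝ ι} {S : β → Matrix ι ι ℝ} (hm : Tendsto m l (𝓝 m₀))
      (hS : Tendsto S l (𝓝 S₀)) (hS_psd : ∀ᶠ x in l, (S x).PosSemidef) :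
      TendstoUniformlyOn (fun x => (multivariateGaussian (m x) (S x)).real)
        (multivariateGaussian m₀ S₀).real l {A | MeasurableSet A} := fun u hu =>
    (tendsto_nhdsWithin_iff.2 ⟨hm.prodMk_nhds hS, hS_psd⟩).eventually
      (tendstoUniformlyOn_multivariateGaussian m₀ hS₀ u hu)
  have h := (comp hm hS hS_psd).sub (comp hm' hS' hS'_psd)
  rwa [sub_self] at h

end MultivariateGaussian

/-! ### Gaussian measures on Hilbert spaces -/

section Hilbert

theorem integral_sub_sq_prod {Ω : Type*} [MeasurableSpace Ω] {P : Measure Ω}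
    [IsProbabilityMeasure P] {f : Ω → ℝ} (hf : MemLp f 2 P) :
    ∫ p : Ω × Ω, (f p.1 - f p.2) ^ 2 ∂P.prod P = 2 * Var[f; P] := by
  have h_fst : Integrable (fun p : Ω × Ω => f p.1 ^ 2) (P.prod P) := hf.integrable_sq.comp_fst P
  have h_snd : Integrable (fun p : Ω × Ω => f p.2 ^ 2) (P.prod P) := hf.integrable_sq.comp_snd P
  have h_mul : Integrable (fun p : Ω × Ω => 2 * (f p.1 * f p.2)) (P.prod P) :=
    ((hf.integrable one_le_two).mul_prod (hf.integrable one_le_two)).const_mul 2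
  have h_sq : ∫ p : Ω × Ω, f p.1 ^ 2 ∂P.prod P = ∫ ω, f ω ^ 2 ∂P := by
    simpa using integral_fun_fst (μ := P) (ν := P) fun ω => f ω ^ 2
  have h_sq' : ∫ p : Ω × Ω, f p.2 ^ 2 ∂P.prod P = ∫ ω, f ω ^ 2 ∂P := by
    simpa using integral_fun_snd (μ := P) (ν := P) fun ω => f ω ^ 2
  have h_expand (p : Ω × Ω) :
      (f p.1 - f p.2) ^ 2 = f p.1 ^ 2 + f p.2 ^ 2 - 2 * (f p.1 * f p.2) := by ring
  have h_add : Integrable (fun p : Ω × Ω => f p.1 ^ 2 + f p.2 ^ 2) (P.prod P) := h_fst.add h_snd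
  simp_rw [h_expand]
  rw [integral_sub h_add h_mul, integral_add h_fst h_snd, integral_const_mul,
    integral_prod_mul, h_sq, h_sq', variance_eq_sub hf]
  simp only [Pi.pow_apply]
  ring

variable {E : Type*} [NormedAddCommGroup E] [InnerProductSpace ℝ E]

theorem memLp_inner {Ω : Type*} [MeasurableSpace Ω] {P : Measure Ω} {f g : Ω → E}
    (hf : MemLp f 4 P) (hg : MemLp g 4 P) : MemLp (fun ω => inner ℝ (f ω) (g ω)) 2 P := by
  have : ENNReal.HolderTriple 4 4 2 := ⟨by
    rw [← two_mul, show (4 : ENNReal) = 2 * 2 by norm_num, ENNReal.mul_inv (by simp) (by simp),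
      ← mul_assoc, ENNReal.mul_inv_cancel (by simp) (by simp), one_mul]⟩
  refine MemLp.of_bilin (inner ℝ) 1 hf hg (hf.1.inner hg.1) (.of_forall fun ω => ?_)
  simpa using nnnorm_inner_le_nnnorm (𝕜 := ℝ) (f ω) (g ω)

theorem integral_inner_prod [CompleteSpace E] [MeasurableSpace E] {μ ν : Measure E} [SFinite μ]
    [SFinite ν] (hμ : Integrable id μ) (hν : Integrable id ν) :
    ∫ p : E × E, inner ℝ p.1 p.2 ∂μ.prod ν = inner ℝ (∫ x, x ∂μ) (∫ x, x ∂ν) :=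
  integral_prod_bilin (innerSL ℝ) hμ hν

variable [MeasurableSpace E] [BorelSpace E] (ν : Measure E) {κ : Type*} [Fintype κ] (u : κ → E)

theorem dotProduct_mulVec_covarianceBilin (t : κ → ℝ) :
    t ⬝ᵥ Matrix.of (fun i j => covarianceBilin ν (u i) (u j)) *ᵥ t =
      covarianceBilin ν (∑ i, t i • u i) (∑ i, t i • u i) := by
  simp only [dotProduct, mulVec, of_apply, map_sum, map_smul, _root_.sum_apply, _root_.smul_apply,
    smul_eq_mul, Finset.mul_sum]
  rw [Finset.sum_comm]
  exact Finset.sum_congr rfl fun i _ => Finset.sum_congr rfl fun j _ => by ring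

theorem posSemidef_covarianceBilin {ι : Type*} [Finite ι] (u : ι → E) :
    (Matrix.of fun i j => covarianceBilin ν (u i) (u j)).PosSemidef := by
  have := Fintype.ofFinite ι
  refine .of_dotProduct_mulVec_nonneg (IsHermitian.ext fun i j => ?_) fun x => ?_
  · simp [covarianceBilin_comm]
  · rw [star_trivial, dotProduct_mulVec_covarianceBilin]
    exact covarianceBilin_self_nonneg _

variable [CompleteSpace E] [SecondCountableTopology E] [IsGaussian ν]

theorem map_inner_add_eq_multivariateGaussian [DecidableEq κ] (β : κ → ℝ) :
    ν.map (fun x => toLp 2 fun k => inner ℝ (u k) x + β k) =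
      multivariateGaussian (toLp 2 fun k => inner ℝ (u k) (∫ x, x ∂ν) + β k)
        (Matrix.of fun i j => covarianceBilin ν (u i) (u j)) := by
  have hmeas : Measurable fun x => toLp 2 fun k => inner ℝ (u k) x + β k := by fun_prop
  have := Measure.isProbabilityMeasure_map hmeas.aemeasurable (μ := ν)
  have h_inner (t : EuclideanSpace ℝ κ) (x : E) :
      inner ℝ (toLp 2 fun k => inner ℝ (u k) x + β k) t =
        inner ℝ x (∑ k, t k • u k) + ∑ k, t k * β k := by
    simp [PiLp.inner_apply, inner_sum, inner_smul_right, mul_add, Finset.sum_add_distrib,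
      real_inner_comm x]
  refine Measure.ext_of_charFun (funext fun t => ?_)
  rw [charFun_apply, integral_map hmeas.aemeasurable (by fun_prop),
    charFun_multivariateGaussian (posSemidef_covarianceBilin ν u), real_inner_comm, h_inner,
    dotProduct_mulVec_covarianceBilin]
  simp_rw [h_inner, Complex.ofReal_add, add_mul, Complex.exp_add]
  rw [integral_mul_const, ← charFun_apply, IsGaussian.charFun_eq', ← Complex.exp_add,
    real_inner_comm]
  congr 1
  simp only [id_eq]
  ring

variable {ν}

/- By rotation invariance of `ν ⊗ ν`, the difference `‖x‖² - ‖y‖²` has the law of `2⟪x, y⟫`. -/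
theorem variance_norm_sq_of_integral_eq_zero (hν : ∫ x, x ∂ν = 0) :
    Var[fun x => ‖x‖ ^ 2; ν] = 2 * ∫ p : E × E, inner ℝ p.1 p.2 ^ 2 ∂ν.prod ν := by
  have hL4 : MemLp (fun x : E => x) 4 ν := IsGaussian.memLp_id ν 4 (by simp)
  have hL2 : MemLp (fun x : E => ‖x‖ ^ 2) 2 ν := by simpa using memLp_inner hL4 hL4
  have h_rotate (p : E × E) :
      (‖(ContinuousLinearMap.rotation (Real.pi / 4) p).1‖ ^ 2 -
        ‖(ContinuousLinearMap.rotation (Real.pi / 4) p).2‖ ^ 2) ^ 2 = 4 * inner ℝ p.1 p.2 ^ 2 := by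
    simp only [ContinuousLinearMap.rotation_apply, Real.cos_pi_div_four, Real.sin_pi_div_four,
      neg_smul, norm_add_sq_real, norm_neg, norm_smul, inner_neg_left, real_inner_smul_left,
      real_inner_smul_right]
    have h_sqrt : (√2 / 2) * (√2 / 2) = 1 / 2 := by
      rw [div_mul_div_comm, Real.mul_self_sqrt zero_le_two]
      norm_num
    linear_combination (16 * inner ℝ p.1 p.2 ^ 2 * (√2 / 2 * (√2 / 2)) +
      8 * inner ℝ p.1 p.2 ^ 2) * h_sqrt
  have h_integral : ∫ p : E × E, (‖p.1‖ ^ 2 - ‖p.2‖ ^ 2) ^ 2 ∂ν.prod ν =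
      4 * ∫ p : E × E, inner ℝ p.1 p.2 ^ 2 ∂ν.prod ν := by
    rw [← IsGaussian.map_rotation_eq_self hν (Real.pi / 4), integral_map (by fun_prop)
      (by fun_prop), IsGaussian.map_rotation_eq_self hν]
    simp_rw [h_rotate]
    exact integral_const_mul _ _
  linarith [integral_sub_sq_prod hL2]

end Hilbert

/-! ### Isotropic Gaussian noise -/

section ClassLaw

variable {d : ℕ} (σ σ' : ℝ) (m u v : EuclideanSpace ℝ (Fin d))

instance : IsGaussian (classLaw σ m) := by
  unfold classLaw
  infer_instance

theorem integral_id_classLaw : ∫ x, x ∂classLaw σ m = m :=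
  integral_id_multivariateGaussian

theorem covarianceBilin_classLaw : covarianceBilin (classLaw σ m) u v = σ ^ 2 * inner ℝ u v := by
  rw [classLaw, covarianceBilin_multivariateGaussian (PosSemidef.one.smul (sq_nonneg σ)),
    smul_mulVec, one_mulVec, dotProduct_smul, smul_eq_mul, EuclideanSpace.inner_eq_star_dotProduct,
    star_trivial, dotProduct_comm]

theorem charFun_classLaw (t : EuclideanSpace ℝ (Fin d)) :
    charFun (classLaw σ m) t =
      Complex.exp (inner ℝ t m * Complex.I - (σ ^ 2 * ‖t‖ ^ 2 : ℝ) / 2) := by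
  rw [IsGaussian.charFun_eq', covarianceBilin_classLaw, real_inner_self_eq_norm_sq]
  simp only [id_eq, integral_id_classLaw]

theorem memLp_inner_classLaw : MemLp (fun x => inner ℝ u x) 2 (classLaw σ m) :=
  IsGaussian.memLp_dual _ (innerSL ℝ u) 2 (by simp)

theorem integral_inner_classLaw : ∫ x, inner ℝ u x ∂classLaw σ m = inner ℝ u m :=
  ((innerSL ℝ u).integral_comp_comm (IsGaussian.integrable_id (μ := classLaw σ m))).trans
    (congrArg (inner ℝ u) (integral_id_classLaw σ m))

theorem variance_inner_classLaw : Var[fun x => inner ℝ u x; classLaw σ m] = σ ^ 2 * ‖u‖ ^ 2 := by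
  rw [← covarianceBilin_self IsGaussian.memLp_two_id, covarianceBilin_classLaw,
    real_inner_self_eq_norm_sq]

theorem integral_inner_sq_classLaw_zero :
    ∫ x, inner ℝ u x ^ 2 ∂classLaw σ 0 = σ ^ 2 * ‖u‖ ^ 2 := by
  rw [← variance_inner_classLaw σ 0 u, variance_of_integral_eq_zero (by fun_prop)
    ((integral_inner_classLaw σ 0 u).trans (inner_zero_right u))]

theorem integral_norm_sq_classLaw_zero :
    ∫ x, ‖x‖ ^ 2 ∂classLaw σ (0 : EuclideanSpace ℝ (Fin d)) = σ ^ 2 * d := by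
  have h_sum (x : EuclideanSpace ℝ (Fin d)) :
      ‖x‖ ^ 2 = ∑ i, inner ℝ (EuclideanSpace.single i (1 : ℝ)) x ^ 2 := by
    simp [EuclideanSpace.real_norm_sq_eq, EuclideanSpace.inner_single_left]
  simp_rw [h_sum]
  rw [integral_finsetSum _ fun i _ => (memLp_inner_classLaw σ 0 _).integrable_sq]
  simp [integral_inner_sq_classLaw_zero, mul_comm]

theorem integral_inner_sq_prod_classLaw_zero :
    ∫ p : EuclideanSpace ℝ (Fin d) × EuclideanSpace ℝ (Fin d), inner ℝ p.1 p.2 ^ 2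
      ∂(classLaw σ 0).prod (classLaw σ' 0) = σ ^ 2 * σ' ^ 2 * d := by
  have hL4 (τ : ℝ) : MemLp (fun x => x) 4 (classLaw τ (0 : EuclideanSpace ℝ (Fin d))) :=
    IsGaussian.memLp_id _ 4 (by simp)
  rw [integral_prod _ (memLp_inner ((hL4 σ).comp_fst _) ((hL4 σ').comp_snd _)).integrable_sq]
  simp only [integral_inner_sq_classLaw_zero, integral_const_mul, integral_norm_sq_classLaw_zero]
  ring

theorem variance_norm_sq_classLaw_zero :
    Var[fun x => ‖x‖ ^ 2; classLaw σ (0 : EuclideanSpace ℝ (Fin d))] = 2 * σ ^ 4 * d := by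
  rw [variance_norm_sq_of_integral_eq_zero (integral_id_classLaw σ 0),
    integral_inner_sq_prod_classLaw_zero]
  ring

end ClassLaw

/-! ### The noise of the class sums -/

section ClassNoise

variable {c d : ℕ} {N : Fin c → ℕ} (σ : ℝ) (μ : Fin c → EuclideanSpace ℝ (Fin d))

/-- The noise `x̄_k - N_k μ_k` of the sum of the feature vectors of class `k`. -/
noncomputable def classNoise (X : Dataset d N) (k : Fin c) : EuclideanSpace ℝ (Fin d) :=
  classSum X k - (N k : ℝ) • μ k

instance : IsProbabilityMeasure (trainLaw N σ μ) := by
  unfold trainLaw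
  infer_instance

@[fun_prop]
theorem measurable_classNoise (k : Fin c) :
    Measurable fun X : Dataset d N => classNoise μ X k := by
  unfold classNoise classSum
  fun_prop

theorem map_sum_sub_classLaw (n : ℕ) (m : EuclideanSpace ℝ (Fin d)) :
    (Measure.pi fun _ : Fin n => classLaw σ m).map (fun x => ∑ j, x j - (n : ℝ) • m) =
      classLaw (√n * σ) 0 := by
  have hmeas : Measurable fun x : Fin n → EuclideanSpace ℝ (Fin d) => ∑ j, x j := by fun_prop
  have : IsProbabilityMeasure ((Measure.pi fun _ : Fin n => classLaw σ m).map
      fun x => ∑ j, x j - (n : ℝ) • m) :=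
    Measure.isProbabilityMeasure_map (by fun_prop)
  refine Measure.ext_of_charFun (funext fun t => ?_)
  have h_map : (Measure.pi fun _ : Fin n => classLaw σ m).map (fun x => ∑ j, x j - (n : ℝ) • m) =
      ((Measure.pi fun _ : Fin n => classLaw σ m).map fun x => ∑ j, x j).map
        (· + -((n : ℝ) • m)) := by
    simp_rw [Measure.map_map (measurable_add_const _) hmeas, Function.comp_def, sub_eq_add_neg]
  rw [h_map, charFun_map_add_const, charFun_map_sum_pi_eq_prod, Finset.prod_apply]
  simp only [charFun_classLaw, Finset.prod_const, Finset.card_univ, Fintype.card_fin,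
    ← Complex.exp_nat_mul, ← Complex.exp_add, mul_pow, Real.sq_sqrt (Nat.cast_nonneg n)]
  congr 1
  simp [inner_smul_right, real_inner_comm]
  ring

theorem hasLaw_classNoise (k : Fin c) :
    HasLaw (fun X : Dataset d N => classNoise μ X k) (classLaw (√(N k) * σ) 0)
      (trainLaw N σ μ) := by
  have h_eval : HasLaw (fun X : Dataset d N => X k)
      (Measure.pi fun _ : Fin (N k) => classLaw σ (μ k)) (trainLaw N σ μ) :=
    (measurePreserving_eval (fun k => Measure.pi fun _ : Fin (N k) => classLaw σ (μ k)) k).hasLaw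
  have h_sum : HasLaw (fun x : Fin (N k) → EuclideanSpace ℝ (Fin d) => ∑ j, x j - (N k : ℝ) • μ k)
      (classLaw (√(N k) * σ) 0) (Measure.pi fun _ => classLaw σ (μ k)) :=
    ⟨by fun_prop, map_sum_sub_classLaw σ (N k) (μ k)⟩
  exact h_sum.fun_comp h_eval

theorem hasLaw_classNoise_prod {k l : Fin c} (hkl : k ≠ l) :
    HasLaw (fun X : Dataset d N => (classNoise μ X k, classNoise μ X l))
      ((classLaw (√(N k) * σ) 0).prod (classLaw (√(N l) * σ) 0)) (trainLaw N σ μ) := by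
  have h_indep : iIndepFun (fun k (X : Dataset d N) => classNoise μ X k) (trainLaw N σ μ) :=
    iIndepFun_pi (μ := fun k => Measure.pi fun _ : Fin (N k) => classLaw σ (μ k))
      (X := fun k (x : Fin (N k) → EuclideanSpace ℝ (Fin d)) => ∑ j, x j - (N k : ℝ) • μ k)
      fun k => by fun_prop
  exact (h_indep.indepFun hkl).hasLaw_prod (hasLaw_classNoise σ μ k) (hasLaw_classNoise σ μ l)

theorem memLp_classNoise (k : Fin c) :
    MemLp (fun X : Dataset d N => classNoise μ X k) 4 (trainLaw N σ μ) :=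
  (hasLaw_classNoise σ μ k).hasGaussianLaw.memLp (by simp)

theorem memLp_inner_classNoise_right (k : Fin c) (u : EuclideanSpace ℝ (Fin d)) :
    MemLp (fun X : Dataset d N => inner ℝ u (classNoise μ X k)) 2 (trainLaw N σ μ) :=
  memLp_inner (memLp_const u) (memLp_classNoise σ μ k)

theorem memLp_inner_classNoise (k l : Fin c) :
    MemLp (fun X : Dataset d N => inner ℝ (classNoise μ X k) (classNoise μ X l)) 2
      (trainLaw N σ μ) :=
  memLp_inner (memLp_classNoise σ μ k) (memLp_classNoise σ μ l)

theorem integral_inner_classNoise_right (k : Fin c) (u : EuclideanSpace ℝ (Fin d)) :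
    ∫ X : Dataset d N, inner ℝ u (classNoise μ X k) ∂trainLaw N σ μ = 0 :=
  ((hasLaw_classNoise σ μ k).integral_comp (f := fun x => inner ℝ u x) (by fun_prop)).trans
    ((integral_inner_classLaw _ 0 u).trans (inner_zero_right u))

theorem variance_inner_classNoise_right (k : Fin c) (u : EuclideanSpace ℝ (Fin d)) :
    Var[fun X : Dataset d N => inner ℝ u (classNoise μ X k); trainLaw N σ μ] =
      N k * σ ^ 2 * ‖u‖ ^ 2 := by
  have h := variance_map (X := fun x => inner ℝ u x) (by fun_prop)
    (hasLaw_classNoise (N := N) σ μ k).aemeasurable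
  rw [(hasLaw_classNoise σ μ k).map_eq, variance_inner_classLaw, mul_pow,
    Real.sq_sqrt (Nat.cast_nonneg _)] at h
  exact h.symm

theorem integral_inner_classNoise (k l : Fin c) :
    ∫ X : Dataset d N, inner ℝ (classNoise μ X k) (classNoise μ X l) ∂trainLaw N σ μ =
      if k = l then N k * σ ^ 2 * d else 0 := by
  split_ifs with hkl
  · subst hkl
    simp_rw [real_inner_self_eq_norm_sq]
    refine ((hasLaw_classNoise σ μ k).integral_comp (f := fun x => ‖x‖ ^ 2) (by fun_prop)).trans ?_
    rw [integral_norm_sq_classLaw_zero, mul_pow, Real.sq_sqrt (Nat.cast_nonneg _)]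
  · refine ((hasLaw_classNoise_prod σ μ hkl).integral_comp (f := fun p => inner ℝ p.1 p.2)
      (by fun_prop)).trans ?_
    rw [integral_inner_prod IsGaussian.integrable_id IsGaussian.integrable_id,
      integral_id_classLaw, inner_zero_left]

theorem variance_inner_classNoise (k l : Fin c) :
    Var[fun X : Dataset d N => inner ℝ (classNoise μ X k) (classNoise μ X l); trainLaw N σ μ] =
      (if k = l then 2 else 1) * N k * N l * σ ^ 4 * d := by
  have h_sqrt (k : Fin c) : (√(N k) * σ) ^ 2 = N k * σ ^ 2 := by
    rw [mul_pow, Real.sq_sqrt (Nat.cast_nonneg _)]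
  split_ifs with hkl
  · subst hkl
    have h := variance_map (X := fun x => ‖x‖ ^ 2) (by fun_prop)
      (hasLaw_classNoise (N := N) σ μ k).aemeasurable
    rw [(hasLaw_classNoise σ μ k).map_eq, variance_norm_sq_classLaw_zero] at h
    simp only [Function.comp_def, ← real_inner_self_eq_norm_sq] at h
    rw [← h]
    linear_combination 2 * d * ((√(N k) * σ) ^ 2 + N k * σ ^ 2) * h_sqrt k
  · rw [variance_of_integral_eq_zero (by fun_prop)
      ((integral_inner_classNoise σ μ k l).trans (if_neg hkl))]
    refine ((hasLaw_classNoise_prod σ μ hkl).integral_comp (f := fun p => inner ℝ p.1 p.2 ^ 2)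
      (by fun_prop)).trans ?_
    rw [integral_inner_sq_prod_classLaw_zero, h_sqrt, h_sqrt]
    ring

end ClassNoise

/-! ### Gram matrix and scaled scores of the class sums -/

section ClassSum

variable {c d : ℕ} {N : Fin c → ℕ}

/-- The scores `⟪v z, x⟫ / σ` of a family of vectors `v`, in units of the noise level. -/
noncomputable def scaledScores (σ : ℝ) (v : Fin c → EuclideanSpace ℝ (Fin d))
    (x : EuclideanSpace ℝ (Fin d)) : EuclideanSpace ℝ (Fin c) :=
  toLp 2 fun z => inner ℝ (v z) x / σ

/-- The expectation of the Gram matrix of the class sums. -/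
noncomputable def expGram (N : Fin c → ℕ) (σ : ℝ) (μ : Fin c → EuclideanSpace ℝ (Fin d)) :
    Matrix (Fin c) (Fin c) ℝ :=
  gram ℝ (fun z => (N z : ℝ) • μ z) + diagonal fun z => N z * σ ^ 2 * d

variable (σ : ℝ) (μ : Fin c → EuclideanSpace ℝ (Fin d))

theorem posSemidef_expGram : (expGram N σ μ).PosSemidef :=
  (posSemidef_gram ℝ _).add (PosSemidef.diagonal fun _ => by positivity)

variable {μ} in
theorem gram_means (hμ : ∀ z w, z ≠ w → inner ℝ (μ z) (μ w) = 0) :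
    gram ℝ (fun z => (N z : ℝ) • μ z) = diagonal fun z => (N z : ℝ) ^ 2 * ‖μ z‖ ^ 2 := by
  ext z w
  rcases eq_or_ne z w with rfl | hzw
  · simp [gram_apply, norm_smul, mul_pow]
  · simp [gram_apply, hzw, real_inner_smul_left, real_inner_smul_right, hμ z w hzw]

variable {μ} in
theorem scaledScores_means (hμ : ∀ z w, z ≠ w → inner ℝ (μ z) (μ w) = 0) (y : Fin c) :
    scaledScores σ (fun z => (N z : ℝ) • μ z) (μ y) =
      EuclideanSpace.single y (N y * (‖μ y‖ ^ 2 / σ)) := by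
  ext z
  rw [PiLp.single_apply]
  simp only [scaledScores, real_inner_smul_left]
  split_ifs with hzy
  · rw [hzy, real_inner_self_eq_norm_sq, mul_div_assoc]
  · rw [hμ z y hzy, mul_zero, zero_div]

theorem scaledScores_classSum (X : Dataset d N) (x : EuclideanSpace ℝ (Fin d)) (z : Fin c) :
    scaledScores σ (classSum X) x z =
      scaledScores σ (fun z => (N z : ℝ) • μ z) x z + inner ℝ (σ⁻¹ • x) (classNoise μ X z) := by
  simp only [scaledScores, classNoise, real_inner_smul_left, inner_sub_right, real_inner_comm x]
  ring

theorem gram_classSum (X : Dataset d N) (z w : Fin c) :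
    gram ℝ (classSum X) z w = gram ℝ (fun z => (N z : ℝ) • μ z) z w +
      inner ℝ ((N z : ℝ) • μ z) (classNoise μ X w) + inner ℝ ((N w : ℝ) • μ w) (classNoise μ X z) +
      inner ℝ (classNoise μ X z) (classNoise μ X w) := by
  simp only [gram_apply, classNoise, inner_sub_left, inner_sub_right,
    real_inner_comm _ ((N w : ℝ) • μ w)]
  ring

theorem integrable_scaledScores_classSum (x : EuclideanSpace ℝ (Fin d)) (z : Fin c) :
    Integrable (fun X : Dataset d N => scaledScores σ (classSum X) x z) (trainLaw N σ μ) := by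
  simp only [scaledScores_classSum σ μ]
  exact (integrable_const _).add ((memLp_inner_classNoise_right σ μ z _).integrable one_le_two)

theorem integral_scaledScores_classSum (x : EuclideanSpace ℝ (Fin d)) (z : Fin c) :
    ∫ X : Dataset d N, scaledScores σ (classSum X) x z ∂trainLaw N σ μ =
      scaledScores σ (fun z => (N z : ℝ) • μ z) x z := by
  simp only [scaledScores_classSum σ μ]
  rw [integral_add (integrable_const _)
    ((memLp_inner_classNoise_right σ μ z _).integrable one_le_two),
    integral_inner_classNoise_right]
  simp

theorem integrable_gram_classSum (z w : Fin c) :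
    Integrable (fun X : Dataset d N => gram ℝ (classSum X) z w) (trainLaw N σ μ) := by
  simp only [gram_classSum μ]
  exact (((integrable_const _).add
    ((memLp_inner_classNoise_right σ μ w _).integrable one_le_two)).add
    ((memLp_inner_classNoise_right σ μ z _).integrable one_le_two)).add
    ((memLp_inner_classNoise σ μ z w).integrable one_le_two)

theorem integral_gram_classSum (z w : Fin c) :
    ∫ X : Dataset d N, gram ℝ (classSum X) z w ∂trainLaw N σ μ = expGram N σ μ z w := by
  have h_left := (memLp_inner_classNoise_right (N := N) σ μ w ((N z : ℝ) • μ z)).integrable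
    one_le_two
  have h_right := (memLp_inner_classNoise_right (N := N) σ μ z ((N w : ℝ) • μ w)).integrable
    one_le_two
  have h_noise := (memLp_inner_classNoise (N := N) σ μ z w).integrable one_le_two
  generalize h_means : gram ℝ (fun z => (N z : ℝ) • μ z) z w = m
  have h_add_left : Integrable (fun X => m + inner ℝ ((N z : ℝ) • μ z) (classNoise μ X w))
    (trainLaw N σ μ) := (integrable_const m).add h_left
  have h_add_right : Integrable (fun X => m + inner ℝ ((N z : ℝ) • μ z) (classNoise μ X w) +
    inner ℝ ((N w : ℝ) • μ w) (classNoise μ X z)) (trainLaw N σ μ) := h_add_left.add h_right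
  simp only [gram_classSum μ, h_means]
  rw [integral_add h_add_right h_noise, integral_add h_add_left h_right,
    integral_add (integrable_const m) h_left]
  simp [integral_inner_classNoise_right, integral_inner_classNoise, expGram, diagonal_apply,
    -gram_apply, h_means]

end ClassSum

/-! ### High-dimensional limits -/

section Scaling

variable {c : ℕ} {s : Fin c → ℝ}

namespace ModelScaling

variable {d : ℕ} {σ : ℝ} {μ : Fin c → EuclideanSpace ℝ (Fin d)}

theorem dim_pos (h : ModelScaling d s σ μ) : 0 < d := by
  refine Nat.pos_of_ne_zero fun hd => h.sigma_pos.ne' ?_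
  subst hd
  simpa using h.sigma_sq

theorem sigma_sq_mul_dim (h : ModelScaling d s σ μ) : σ ^ 2 * d = 1 := by
  rw [h.sigma_sq, one_div, inv_mul_cancel₀ (Nat.cast_ne_zero.2 h.dim_pos.ne')]

theorem norm_sq_div_sigma (h : ModelScaling d s σ μ) (i : Fin c) : ‖μ i‖ ^ 2 / σ = s i := by
  have h_sigma : σ = 1 / √(d : ℝ) := by
    rw [← Real.sqrt_sq h.sigma_pos.le, h.sigma_sq, Real.sqrt_div zero_le_one, Real.sqrt_one]
  have h_sqrt : √(d : ℝ) ≠ 0 := (Real.sqrt_pos.2 (Nat.cast_pos.2 h.dim_pos)).ne'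
  rw [h.norm_sq, h_sigma, div_div_div_cancel_right₀ h_sqrt, div_one]

end ModelScaling

variable {N : Fin c → ℕ} {σ : ℕ → ℝ} {μ : (d : ℕ) → Fin c → EuclideanSpace ℝ (Fin d)}

theorem tendsto_inner_classNoise_right {u : ∀ d, EuclideanSpace ℝ (Fin d)}
    (hu : Tendsto (fun d => σ d ^ 2 * ‖u d‖ ^ 2) atTop (𝓝 0)) (z : Fin c) :
    Tendsto (fun x : Σ d, Dataset d N => inner ℝ (u x.1) (classNoise (μ x.1) x.2 z))
      (probFilter atTop fun d => trainLaw N (σ d) (μ d)) (𝓝 0) := by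
  refine tendsto_probFilter_of_tendsto_variance (P := fun d => trainLaw N (σ d) (μ d))
    (F := fun d X => inner ℝ (u d) (classNoise (μ d) X z))
    (.of_forall fun d => memLp_inner_classNoise_right (σ d) (μ d) z (u d)) ?_ ?_
  · simp_rw [integral_inner_classNoise_right]
    exact tendsto_const_nhds
  · simp_rw [variance_inner_classNoise_right, mul_assoc]
    simpa using hu.const_mul (N z : ℝ)

variable (hscale : ∀ᶠ d in atTop, ModelScaling d s (σ d) (μ d))
include hscale

theorem tendsto_sigma_sq : Tendsto (fun d => σ d ^ 2) atTop (𝓝 0) := by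
  refine (tendsto_one_div_atTop_nhds_zero_nat (𝕜 := ℝ)).congr' ?_
  filter_upwards [hscale] with d hd
  exact hd.sigma_sq.symm

theorem tendsto_norm_sq (i : Fin c) : Tendsto (fun d => ‖μ d i‖ ^ 2) atTop (𝓝 0) := by
  have h_sqrt : Tendsto (fun d : ℕ => √(d : ℝ)) atTop atTop :=
    Real.tendsto_sqrt_atTop.comp tendsto_natCast_atTop_atTop
  refine (tendsto_const_nhds (x := s i).div_atTop h_sqrt).congr' ?_
  filter_upwards [hscale] with d hd
  exact (hd.norm_sq i).symm

theorem tendsto_scaledScores_means (y : Fin c) :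
    Tendsto (fun d => scaledScores (σ d) (fun z => (N z : ℝ) • μ d z) (μ d y)) atTop
      (𝓝 (EuclideanSpace.single y (N y * s y))) := by
  refine tendsto_const_nhds.congr' ?_
  filter_upwards [hscale] with d hd
  rw [scaledScores_means (σ d) hd.orthogonal, hd.norm_sq_div_sigma]

theorem tendsto_scaledScores_classSum (y : Fin c) :
    Tendsto (fun x : Σ d, Dataset d N => scaledScores (σ x.1) (classSum x.2) (μ x.1 y))
      (probFilter atTop fun d => trainLaw N (σ d) (μ d))
      (𝓝 (EuclideanSpace.single y (N y * s y))) := by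
  have h_noise (z : Fin c) := tendsto_inner_classNoise_right (N := N) (σ := σ) (μ := μ)
    (u := fun d => (σ d)⁻¹ • μ d y) (z := z) <| (tendsto_norm_sq hscale y).congr' <| by
      filter_upwards [hscale] with d hd
      rw [norm_smul, mul_pow, norm_inv, inv_pow, Real.norm_eq_abs, sq_abs,
        mul_inv_cancel_left₀ (pow_ne_zero 2 hd.sigma_pos.ne')]
  have h_means := (tendsto_scaledScores_means (N := N) hscale y).comp
    (tendsto_fst_probFilter (P := fun d => trainLaw N (σ d) (μ d)))
  refine ((PiLp.continuous_toLp 2 _).tendsto _).comp (tendsto_pi_nhds.2 fun z => ?_)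
  have h_coord := (((PiLp.continuous_ofLp 2 _).tendsto _).comp h_means).apply_nhds z
  have h_sum := h_coord.add (h_noise z)
  rw [add_zero] at h_sum
  exact h_sum.congr fun x => (scaledScores_classSum (σ x.1) (μ x.1) x.2 (μ x.1 y) z).symm

theorem tendsto_gram_means :
    Tendsto (fun d => gram ℝ (fun z => (N z : ℝ) • μ d z)) atTop (𝓝 0) := by
  rw [← diagonal_zero]
  refine Tendsto.congr' (hscale.mono fun d hd => (gram_means hd.orthogonal).symm) ?_
  refine ((continuous_id.matrix_diagonal).tendsto _).comp (tendsto_pi_nhds.2 fun z => ?_)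
  simpa using (tendsto_norm_sq hscale z).const_mul ((N z : ℝ) ^ 2)

theorem tendsto_expGram :
    Tendsto (fun d => expGram N (σ d) (μ d)) atTop (𝓝 (diagonal fun z => (N z : ℝ))) := by
  rw [← zero_add (diagonal fun z => (N z : ℝ))]
  refine ((tendsto_gram_means (N := N) hscale).add_const _).congr' ?_
  filter_upwards [hscale] with d hd
  simp only [expGram, mul_assoc, hd.sigma_sq_mul_dim, mul_one]

theorem tendsto_inner_classNoise (z w : Fin c) :
    Tendsto (fun x : Σ d, Dataset d N =>
        inner ℝ (classNoise (μ x.1) x.2 z) (classNoise (μ x.1) x.2 w))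
      (probFilter atTop fun d => trainLaw N (σ d) (μ d))
      (𝓝 (diagonal (fun z => (N z : ℝ)) z w)) := by
  refine tendsto_probFilter_of_tendsto_variance (P := fun d => trainLaw N (σ d) (μ d))
    (F := fun d X => inner ℝ (classNoise (μ d) X z) (classNoise (μ d) X w))
    (.of_forall fun d => memLp_inner_classNoise (σ d) (μ d) z w) ?_ ?_
  · refine tendsto_const_nhds.congr' ?_
    filter_upwards [hscale] with d hd
    rw [integral_inner_classNoise, diagonal_apply, mul_assoc, hd.sigma_sq_mul_dim, mul_one]
  · have h := (tendsto_sigma_sq hscale).const_mul ((if z = w then 2 else 1) * (N z : ℝ) * N w)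
    rw [mul_zero] at h
    refine h.congr' ?_
    filter_upwards [hscale] with d hd
    rw [variance_inner_classNoise]
    linear_combination -((if z = w then 2 else 1) * (N z : ℝ) * N w * σ d ^ 2) *
      hd.sigma_sq_mul_dim

theorem tendsto_gram_classSum :
    Tendsto (fun x : Σ d, Dataset d N => gram ℝ (classSum x.2))
      (probFilter atTop fun d => trainLaw N (σ d) (μ d))
      (𝓝 (diagonal fun z => (N z : ℝ))) := by
  have h_cross (z w : Fin c) := tendsto_inner_classNoise_right (N := N) (σ := σ) (μ := μ)
    (u := fun d => (N z : ℝ) • μ d z) (z := w) <| by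
      simpa [norm_smul, mul_pow] using
        (tendsto_sigma_sq hscale).mul ((tendsto_norm_sq hscale z).const_mul ((N z : ℝ) ^ 2))
  refine tendsto_pi_nhds.2 fun z => tendsto_pi_nhds.2 fun w => ?_
  have h_means := (((tendsto_gram_means (N := N) hscale).apply_nhds z).apply_nhds w).comp
    (tendsto_fst_probFilter (P := fun d => trainLaw N (σ d) (μ d)))
  have h_sum := ((h_means.add (h_cross z w)).add (h_cross w z)).add
    (tendsto_inner_classNoise hscale z w)
  simp only [Matrix.zero_apply, add_zero, zero_add] at h_sum
  exact h_sum.congr fun x => (gram_classSum (μ x.1) x.2 z w).symm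

end Scaling

/-! ### Score gaps -/

section ScoreLaw

variable {c d : ℕ} (σ : ℝ) (μ W : Fin c → EuclideanSpace ℝ (Fin d)) (b : Fin c → ℝ) (y k : Fin c)

/-- The normal distribution `N(ν^{(y)}, Σ^{(y)})` whose parameters are the score statistics of a
predictor. For `σ > 0` it is the law of the gaps `(z_y - z_i) / σ` between the score of class `y`
and the scores of all classes on a test point of class `y`. -/
noncomputable def scoreLaw : Measure (EuclideanSpace ℝ (Fin c)) :=
  multivariateGaussian (toLp 2 (scoreMean σ μ W b y)) (Matrix.of (scoreCov W y))

variable {σ} in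
theorem map_scores_classLaw (hσ : 0 < σ) :
    (classLaw σ (μ y)).map (fun x => toLp 2 fun i => (scores W b x y - scores W b x i) / σ) =
      scoreLaw σ μ W b y := by
  have h_affine (x : EuclideanSpace ℝ (Fin d)) (i : Fin c) :
      (scores W b x y - scores W b x i) / σ =
        inner ℝ (σ⁻¹ • (W y - W i)) x + (b y - b i) / σ := by
    rw [real_inner_smul_left, inner_sub_left, scores, scores]
    ring
  simp_rw [h_affine]
  rw [map_inner_add_eq_multivariateGaussian, integral_id_classLaw, scoreLaw]
  congr 2
  · ext i
    rw [scoreMean, real_inner_smul_left]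
    ring
  · ext i j
    simp only [covarianceBilin_classLaw, real_inner_smul_left, real_inner_smul_right,
      scoreCov]
    field_simp

theorem measurableSet_nonneg : MeasurableSet {v : EuclideanSpace ℝ (Fin c) | ∀ i, 0 ≤ v i} := by
  rw [Set.ofPred_forall]
  exact .iInter fun i => measurableSet_le measurable_const (by fun_prop)

theorem measurableSet_scores_le :
    MeasurableSet {x | ∀ i, scores W b x i ≤ scores W b x y} := by
  unfold scores
  rw [Set.ofPred_forall]
  exact .iInter fun i => measurableSet_le (by fun_prop) (by fun_prop)

theorem err_eq_measureReal :
    err σ μ W b y = (classLaw σ (μ y)).real {x | ∀ i, scores W b x i ≤ scores W b x y}ᶜ := by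
  have h_loss : (fun x => zeroOneLoss (scores W b x) y) =
      {x | ∀ i, scores W b x i ≤ scores W b x y}ᶜ.indicator 1 := by
    ext x
    by_cases hx : ∀ i, scores W b x i ≤ scores W b x y <;> simp [zeroOneLoss, hx]
  rw [err, h_loss, integral_indicator_one (measurableSet_scores_le W b y).compl]

theorem errTo_le_err : errTo σ μ W b y k ≤ err σ μ W b y := by
  rw [err_eq_measureReal, errTo]
  exact measureReal_mono fun x (hx : _ > _) h => (h k).not_gt hx

theorem err_le_worstClassErr : err σ μ W b y ≤ worstClassErr σ μ W b :=
  le_ciSup (f := err σ μ W b) (Set.finite_range _).bddAbove y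

theorem maxPairs_errTo_le_worstClassErr : maxPairs (errTo σ μ W b) ≤ worstClassErr σ μ W b :=
  Real.iSup_le
    (fun p => (errTo_le_err σ μ W b p.1.1 p.1.2).trans (err_le_worstClassErr σ μ W b p.1.1))
    (Real.iSup_nonneg fun y => err_eq_measureReal σ μ W b y ▸ measureReal_nonneg)

theorem measurable_scores_sub :
    Measurable fun x => toLp 2 fun i => (scores W b x y - scores W b x i) / σ := by
  unfold scores
  fun_prop

variable {σ} (hσ : 0 < σ)
include hσ

theorem err_eq_scoreLaw :
    err σ μ W b y = 1 - (scoreLaw σ μ W b y).real {v | ∀ i, 0 ≤ v i} := by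
  rw [err_eq_measureReal, probReal_compl_eq_one_sub (measurableSet_scores_le W b y),
    ← map_scores_classLaw μ W b y hσ,
    map_measureReal_apply (measurable_scores_sub σ W b y) measurableSet_nonneg]
  simp [le_div_iff₀ hσ]

theorem errTo_eq_scoreLaw :
    errTo σ μ W b y k = (scoreLaw σ μ W b y).real {v | v k < 0} := by
  rw [errTo, ← map_scores_classLaw μ W b y hσ,
    map_measureReal_apply (measurable_scores_sub σ W b y)
      (measurableSet_lt (by fun_prop) measurable_const)]
  simp [div_neg_iff, hσ, hσ.not_gt]

end ScoreLaw

section ScoreGap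

variable {c d : ℕ}

/-- The score gaps `(z_y - z_i) / σ` of the predictor with coefficients `α`, `b`, as an affine
function of the scaled scores `t` of the class sums. -/
noncomputable def scoreGap (σ : ℝ) (α : Fin c → Fin c → ℝ) (b : Fin c → ℝ) (y : Fin c)
    (t : EuclideanSpace ℝ (Fin c)) : EuclideanSpace ℝ (Fin c) :=
  toLp 2 fun i => (α y - α i) ⬝ᵥ ofLp t + (b y - b i) / σ

variable (σ : ℝ) (μ : Fin c → EuclideanSpace ℝ (Fin d)) (α : Fin c → Fin c → ℝ) (b : Fin c → ℝ)
  (y : Fin c)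

theorem measurable_scoreGap : Measurable (scoreGap σ α b y) := by
  unfold scoreGap dotProduct
  fun_prop

theorem map_scoreGap_multivariateGaussian (t : EuclideanSpace ℝ (Fin c))
    {S : Matrix (Fin c) (Fin c) ℝ} (hS : S.PosSemidef) :
    (multivariateGaussian t S).map (scoreGap σ α b y) =
      multivariateGaussian (scoreGap σ α b y t)
        (Matrix.of fun i j => (α y - α i) ⬝ᵥ S *ᵥ (α y - α j)) := by
  have h_inner (i : Fin c) (x : EuclideanSpace ℝ (Fin c)) :
      (α y - α i) ⬝ᵥ ofLp x = inner ℝ (toLp 2 (α y - α i)) x := by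
    simp [EuclideanSpace.inner_eq_star_dotProduct, dotProduct_comm]
  unfold scoreGap
  simp_rw [h_inner]
  rw [map_inner_add_eq_multivariateGaussian, integral_id_multivariateGaussian]
  congr 1
  ext i j
  simp [covarianceBilin_multivariateGaussian hS, EuclideanSpace.inner_eq_star_dotProduct,
    dotProduct_comm, -toLp_sub]

variable {N : Fin c → ℕ}

theorem weights_sub_weights (X : Dataset d N) (i : Fin c) :
    weights α X y - weights α X i = ∑ z, (α y - α i) z • classSum X z := by
  simp [weights, sub_smul, Finset.sum_sub_distrib]

theorem scoreMean_weights (X : Dataset d N) (i : Fin c) :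
    scoreMean σ μ (weights α X) b y i =
      scoreGap σ α b y (scaledScores σ (classSum X) (μ y)) i := by
  simp only [scoreMean, weights_sub_weights, sum_inner, real_inner_smul_left, scoreGap,
    scaledScores, dotProduct, Pi.sub_apply, ← mul_div_assoc, ← Finset.sum_div]
  ring

theorem scoreCov_weights (X : Dataset d N) (i j : Fin c) :
    scoreCov (weights α X) y i j = (α y - α i) ⬝ᵥ gram ℝ (classSum X) *ᵥ (α y - α j) := by
  rw [scoreCov, weights_sub_weights, weights_sub_weights, ← star_dotProduct_gram_mulVec,
    star_trivial]

theorem scoreLaw_weights (X : Dataset d N) :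
    scoreLaw σ μ (weights α X) b y =
      (multivariateGaussian (scaledScores σ (classSum X) (μ y)) (gram ℝ (classSum X))).map
        (scoreGap σ α b y) := by
  rw [map_scoreGap_multivariateGaussian _ _ _ _ _ (posSemidef_gram ℝ _), scoreLaw]
  congr 1
  · ext i
    exact scoreMean_weights σ μ α b y X i
  · ext i j
    exact scoreCov_weights α y X i j

end ScoreGap

/-! ### Expected score statistics -/

section ExpectedStatistics

theorem integrable_dotProduct {Ω ι : Type*} [Fintype ι] [MeasurableSpace Ω] {P : Measure Ω}
    {f : Ω → ι → ℝ} (a : ι → ℝ) (hf : ∀ i, Integrable (fun ω => f ω i) P) :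
    Integrable (fun ω => a ⬝ᵥ f ω) P :=
  integrable_finsetSum _ fun i _ => (hf i).const_mul (a i)

theorem integral_dotProduct {Ω ι : Type*} [Fintype ι] [MeasurableSpace Ω] {P : Measure Ω}
    {f : Ω → ι → ℝ} (a : ι → ℝ) (hf : ∀ i, Integrable (fun ω => f ω i) P) :
    ∫ ω, a ⬝ᵥ f ω ∂P = a ⬝ᵥ fun i => ∫ ω, f ω i ∂P := by
  simp only [dotProduct]
  rw [integral_finsetSum _ fun i _ => (hf i).const_mul (a i)]
  simp only [integral_const_mul]

variable {c d : ℕ} {N : Fin c → ℕ} {s : Fin c → ℝ} {σ : ℝ} {μ : Fin c → EuclideanSpace ℝ (Fin d)}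
  (α : Fin c → Fin c → ℝ) (b : Fin c → ℝ) (y : Fin c)

section Integrals

variable (N σ μ)

theorem integrable_scoreMean (i : Fin c) :
    Integrable (fun X : Dataset d N => scoreMean σ μ (weights α X) b y i) (trainLaw N σ μ) := by
  simp only [scoreMean_weights]
  exact (integrable_dotProduct _ fun z => integrable_scaledScores_classSum σ μ (μ y) z).add
    (integrable_const _)

theorem expScoreMean_eq_scoreGap :
    expScoreMean N σ μ α b y =
      scoreGap σ α b y (scaledScores σ (fun z => (N z : ℝ) • μ z) (μ y)) := by
  have h_int (z : Fin c) := integrable_scaledScores_classSum (N := N) σ μ (μ y) z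
  ext i
  simp only [expScoreMean, scoreMean_weights, scoreGap]
  rw [integral_add (integrable_dotProduct _ h_int) (integrable_const _),
    integral_dotProduct _ h_int]
  simp [integral_scaledScores_classSum]

theorem integrable_gram_classSum_mulVec (a : Fin c → ℝ) (z : Fin c) :
    Integrable (fun X : Dataset d N => (gram ℝ (classSum X) *ᵥ a) z) (trainLaw N σ μ) := by
  simp only [mulVec, dotProduct_comm _ a]
  exact integrable_dotProduct a fun w => integrable_gram_classSum σ μ z w

theorem integrable_scoreCov (i j : Fin c) :
    Integrable (fun X : Dataset d N => scoreCov (weights α X) y i j) (trainLaw N σ μ) := by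
  simp only [scoreCov_weights]
  exact integrable_dotProduct _ fun z => integrable_gram_classSum_mulVec N σ μ _ z

theorem expScoreCov_eq_expGram :
    expScoreCov N σ μ α y =
      Matrix.of fun i j => (α y - α i) ⬝ᵥ expGram N σ μ *ᵥ (α y - α j) := by
  ext i j
  simp only [expScoreCov, scoreCov_weights, of_apply]
  rw [integral_dotProduct _ fun z => integrable_gram_classSum_mulVec N σ μ _ z]
  congr 1
  ext z
  simp only [mulVec, dotProduct_comm _ (α y - α j)]
  rw [integral_dotProduct _ fun w => integrable_gram_classSum σ μ z w]
  simp only [integral_gram_classSum]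

theorem multivariateGaussian_expScoreMean_expScoreCov :
    multivariateGaussian (expScoreMean N σ μ α b y) (expScoreCov N σ μ α y) =
      (multivariateGaussian (scaledScores σ (fun z => (N z : ℝ) • μ z) (μ y))
        (expGram N σ μ)).map (scoreGap σ α b y) := by
  rw [map_scoreGap_multivariateGaussian _ _ _ _ _ (posSemidef_expGram σ μ),
    expScoreMean_eq_scoreGap, expScoreCov_eq_expGram]

end Integrals

theorem expScoreMean_apply (hμ : ∀ z w, z ≠ w → inner ℝ (μ z) (μ w) = 0) (i : Fin c) :
    expScoreMean N σ μ α b y i =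
      ((α y y - α i y) * N y * ‖μ y‖ ^ 2 + b y - b i) / σ := by
  rw [expScoreMean_eq_scoreGap, scaledScores_means σ hμ]
  simp only [scoreGap, PiLp.ofLp_single, dotProduct_single, Pi.sub_apply]
  ring

variable (hN : ∀ i, 0 < N i)
include hN

theorem expGram_eq_diagonal (hμ : ∀ z w, z ≠ w → inner ℝ (μ z) (μ w) = 0) :
    expGram N σ μ = diagonal fun z => (N z : ℝ) ^ 2 * xi N σ μ z := by
  rw [expGram, gram_means hμ, diagonal_add]
  congr 1
  ext z
  have hNz : (N z : ℝ) ≠ 0 := Nat.cast_ne_zero.2 (hN z).ne'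
  rw [xi]
  field_simp

theorem expScoreCov_apply (hμ : ∀ z w, z ≠ w → inner ℝ (μ z) (μ w) = 0) (i j : Fin c) :
    expScoreCov N σ μ α y i j =
      ∑ z, (α y z - α i z) * (α y z - α j z) * (N z : ℝ) ^ 2 * xi N σ μ z := by
  rw [expScoreCov_eq_expGram, of_apply, expGram_eq_diagonal hN hμ]
  refine Finset.sum_congr rfl fun z _ => ?_
  rw [mulVec_diagonal]
  simp only [Pi.sub_apply]
  ring

end ExpectedStatistics

section PairwiseApproximation

theorem gaussianReal_real_Iio_zero (a : ℝ) {v : ℝ} (hv : 0 < v) :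
    (gaussianReal a v.toNNReal).real (Set.Iio 0) = gaussianQ (a / √v) := by
  have h_map : (gaussianReal 0 1).map (fun t => a - √v * t) = gaussianReal a v.toNNReal := by
    have h_comp : (fun t => a - √v * t) = (fun t => a - t) ∘ fun t => √v * t := rfl
    rw [h_comp, ← Measure.map_map (by fun_prop) (by fun_prop), gaussianReal_map_const_mul,
      gaussianReal_map_const_sub]
    congr 1
    · simp
    · ext
      simp [Real.sq_sqrt hv.le, hv.le]
  rw [← h_map, map_measureReal_apply (by fun_prop) measurableSet_Iio, gaussianQ]
  congr 1
  ext t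
  simp [div_lt_iff₀ (Real.sqrt_pos.2 hv), mul_comm]

theorem multivariateGaussian_real_coord_neg {ι : Type*} [Fintype ι] [DecidableEq ι]
    (m : EuclideanSpace ℝ ι) {S : Matrix ι ι ℝ} (hS : S.PosSemidef) {i : ι} (hi : 0 < S i i) :
    (multivariateGaussian m S).real {v | v i < 0} = gaussianQ (m i / √(S i i)) := by
  rw [← gaussianReal_real_Iio_zero _ hi,
    ← (measurePreserving_eval_multivariateGaussian hS).map_eq,
    map_measureReal_apply (by fun_prop) measurableSet_Iio]
  rfl

variable {c d : ℕ} {N : Fin c → ℕ} {s : Fin c → ℝ} {σ : ℝ} {μ : Fin c → EuclideanSpace ℝ (Fin d)}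
  {α : Fin c → Fin c → ℝ} {y k : Fin c}

theorem posSemidef_expScoreCov (N : Fin c → ℕ) (σ : ℝ) (μ : Fin c → EuclideanSpace ℝ (Fin d))
    (α : Fin c → Fin c → ℝ) (y : Fin c) : (expScoreCov N σ μ α y).PosSemidef := by
  rw [expScoreCov_eq_expGram]
  have h := (posSemidef_expGram (N := N) σ μ).mul_mul_conjTranspose_same
    (Matrix.of fun i => α y - α i)
  rwa [conjTranspose_eq_transpose_of_trivial, mul_assoc] at h

theorem xi_pos (h : ModelScaling d s σ μ) (hN : ∀ i, 0 < N i) (z : Fin c) : 0 < xi N σ μ z := by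
  have hNz : (0 : ℝ) < N z := Nat.cast_pos.2 (hN z)
  rw [xi, h.sigma_sq_mul_dim]
  positivity

theorem expScoreCov_self (hN : ∀ i, 0 < N i) (h : ModelScaling d s σ μ) :
    expScoreCov N σ μ α y k k = ∑ i, (α y i - α k i) ^ 2 * (N i : ℝ) ^ 2 * xi N σ μ i := by
  simp only [expScoreCov_apply α y hN h.orthogonal, sq (α y _ - α k _)]

theorem expScoreCov_self_pos (hN : ∀ i, 0 < N i) (h : ModelScaling d s σ μ) (hα : α y ≠ α k) :
    0 < expScoreCov N σ μ α y k k := by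
  have h_weight (i : Fin c) : 0 < (N i : ℝ) ^ 2 * xi N σ μ i :=
    mul_pos (pow_pos (Nat.cast_pos.2 (hN i)) 2) (xi_pos h hN i)
  obtain ⟨z, hz⟩ := Function.ne_iff.1 hα
  simp only [expScoreCov_self hN h, mul_assoc]
  exact Finset.sum_pos' (fun i _ => mul_nonneg (sq_nonneg _) (h_weight i).le)
    ⟨z, Finset.mem_univ z, mul_pos (sq_pos_of_ne_zero (sub_ne_zero.2 hz)) (h_weight z)⟩

theorem approxErrTo_eq_measureReal (b : Fin c → ℝ) (hN : ∀ i, 0 < N i)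
    (h : ModelScaling d s σ μ) (hα : α y ≠ α k) :
    approxErrTo N σ μ α b y k =
      (multivariateGaussian (expScoreMean N σ μ α b y) (expScoreCov N σ μ α y)).real
        {v | v k < 0} := by
  rw [multivariateGaussian_real_coord_neg _ (posSemidef_expScoreCov N σ μ α y)
    (expScoreCov_self_pos hN h hα), expScoreMean_apply α b y h.orthogonal, expScoreCov_self hN h,
    approxErrTo, div_div]

end PairwiseApproximation

/-! ### Limits of the errors -/

section ErrorLimits

variable {c : ℕ} {N : Fin c → ℕ} {s : Fin c → ℝ} {σ : ℕ → ℝ}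
  {μ : (d : ℕ) → Fin c → EuclideanSpace ℝ (Fin d)} (hN : ∀ i, 0 < N i)
  (hscale : ∀ᶠ d in atTop, ModelScaling d s (σ d) (μ d))
  (α : ℕ → Fin c → Fin c → ℝ) (b : ℕ → Fin c → ℝ)
include hN hscale

theorem tendstoUniformlyOn_scoreLaw_sub (y : Fin c) :
    TendstoUniformlyOn
      (fun (x : Σ d, Dataset d N) A =>
        (scoreLaw (σ x.1) (μ x.1) (weights (α x.1) x.2) (b x.1) y).real A -
          (multivariateGaussian (expScoreMean N (σ x.1) (μ x.1) (α x.1) (b x.1) y)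
            (expScoreCov N (σ x.1) (μ x.1) (α x.1) y)).real A)
      0 (probFilter atTop fun d => trainLaw N (σ d) (μ d)) {A | MeasurableSet A} := by
  have h_uniform := tendstoUniformlyOn_multivariateGaussian_sub
    (PosDef.diagonal fun z => Nat.cast_pos.2 (hN z))
    (tendsto_scaledScores_classSum (N := N) hscale y) (tendsto_gram_classSum hscale)
    (.of_forall fun x => posSemidef_gram ℝ _)
    ((tendsto_scaledScores_means hscale y).comp tendsto_fst_probFilter)
    ((tendsto_expGram hscale).comp tendsto_fst_probFilter)
    (.of_forall fun x => posSemidef_expGram _ _)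
  rw [Metric.tendstoUniformlyOn_iff] at h_uniform ⊢
  intro ε hε
  filter_upwards [h_uniform ε hε] with x hx A hA
  have h_preimage := hx _ (measurable_scoreGap (σ x.1) (α x.1) (b x.1) y hA)
  rwa [scoreLaw_weights, multivariateGaussian_expScoreMean_expScoreCov,
    map_measureReal_apply (measurable_scoreGap _ _ _ _) hA,
    map_measureReal_apply (measurable_scoreGap _ _ _ _) hA]

theorem tendstoInProb_err (y : Fin c) :
    TendstoInProb (fun d => trainLaw N (σ d) (μ d))
      (fun d X => err (σ d) (μ d) (weights (α d) X) (b d) y)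
      (fun d => approxErr N (σ d) (μ d) (α d) (b d) y) := by
  rw [TendstoInProb.iff_tendsto_sub, ← neg_zero]
  refine ((tendstoUniformlyOn_scoreLaw_sub hN hscale α b y).tendsto_at
    measurableSet_nonneg).neg.congr' ?_
  filter_upwards [tendsto_fst_probFilter.eventually hscale] with x hx
  rw [err_eq_scoreLaw _ _ _ _ hx.sigma_pos, approxErr, sub_sub_sub_cancel_left, neg_sub]

theorem tendstoInProb_errTo {y k : Fin c} (hα : ∀ᶠ d in atTop, α d y ≠ α d k) :
    TendstoInProb (fun d => trainLaw N (σ d) (μ d))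
      (fun d X => errTo (σ d) (μ d) (weights (α d) X) (b d) y k)
      (fun d => approxErrTo N (σ d) (μ d) (α d) (b d) y k) := by
  rw [TendstoInProb.iff_tendsto_sub]
  have h_meas : MeasurableSet {v : EuclideanSpace ℝ (Fin c) | v k < 0} :=
    measurableSet_lt (by fun_prop) measurable_const
  refine ((tendstoUniformlyOn_scoreLaw_sub hN hscale α b y).tendsto_at h_meas).congr' ?_
  filter_upwards [tendsto_fst_probFilter.eventually hscale,
    tendsto_fst_probFilter.eventually hα] with x hx hαx
  rw [errTo_eq_scoreLaw _ _ _ _ _ hx.sigma_pos, approxErrTo_eq_measureReal _ hN hx hαx]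

theorem tendstoInProb_worstClassErr :
    TendstoInProb (fun d => trainLaw N (σ d) (μ d))
      (fun d X => worstClassErr (σ d) (μ d) (weights (α d) X) (b d))
      (fun d => ⨆ y, approxErr N (σ d) (μ d) (α d) (b d) y) :=
  .iSup fun y => tendstoInProb_err hN hscale α b y

end ErrorLimits

end ImbalancedMixture

theorem mainTheorem8 (c : ℕ) (hc : 2 ≤ c) (N : Fin c → ℕ) (hN : ∀ i, 0 < N i)
    (s : Fin c → ℝ) (σ : ℕ → ℝ) (μ : (d : ℕ) → Fin c → EuclideanSpace ℝ (Fin d))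
    (hscale : ∀ᶠ d in atTop, ModelScaling d s (σ d) (μ d))
    (α : ℕ → Fin c → Fin c → ℝ) (b : ℕ → Fin c → ℝ) :
    -- the expected score statistics exist and are given explicitly
    (∀ d, ModelScaling d s (σ d) (μ d) → ∀ y,
      (∀ i,
        Integrable (fun X : Dataset d N => scoreMean (σ d) (μ d) (weights (α d) X) (b d) y i)
          (trainLaw N (σ d) (μ d)) ∧
        expScoreMean N (σ d) (μ d) (α d) (b d) y i =
          ((α d y y - α d i y) * N y * ‖μ d y‖ ^ 2 + b d y - b d i) / σ d) ∧
      (∀ i j,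
        Integrable (fun X : Dataset d N => scoreCov (weights (α d) X) y i j)
          (trainLaw N (σ d) (μ d)) ∧
        expScoreCov N (σ d) (μ d) (α d) y i j =
          ∑ z, (α d y z - α d i z) * (α d y z - α d j z) * (N z : ℝ) ^ 2 *
            xi N (σ d) (μ d) z)) ∧
    -- the limit of the class errors
    (∀ y,
      TendstoInProb (fun d => trainLaw N (σ d) (μ d))
        (fun d X => err (σ d) (μ d) (weights (α d) X) (b d) y)
        (fun d => approxErr N (σ d) (μ d) (α d) (b d) y) ∧
      ∀ l : ℝ, Tendsto (fun d => approxErr N (σ d) (μ d) (α d) (b d) y) atTop (𝓝 l) →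
        TendstoInProb (fun d => trainLaw N (σ d) (μ d))
          (fun d X => err (σ d) (μ d) (weights (α d) X) (b d) y) (fun _ => l)) ∧
    -- the limit of the worst class error
    TendstoInProb (fun d => trainLaw N (σ d) (μ d))
      (fun d X => worstClassErr (σ d) (μ d) (weights (α d) X) (b d))
      (fun d => ⨆ y, approxErr N (σ d) (μ d) (α d) (b d) y) ∧
    -- the limit of the pairwise errors
    (∀ y k, k ≠ y → (∀ᶠ d in atTop, α d y ≠ α d k) →
      TendstoInProb (fun d => trainLaw N (σ d) (μ d))
        (fun d X => errTo (σ d) (μ d) (weights (α d) X) (b d) y k)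
        (fun d => approxErrTo N (σ d) (μ d) (α d) (b d) y k)) ∧
    -- the lower bound on the worst class error
    ((∀ y k, k ≠ y → ∀ᶠ d in atTop, α d y ≠ α d k) →
      (∀ ε : ℝ, 0 < ε →
        Tendsto (fun d => trainLaw N (σ d) (μ d)
          {X | worstClassErr (σ d) (μ d) (weights (α d) X) (b d) <
            maxPairs (approxErrTo N (σ d) (μ d) (α d) (b d)) - ε}) atTop (𝓝 0)) ∧
      ∀ q : Fin c → Fin c → ℝ,
        (∀ y k, k ≠ y →
          Tendsto (fun d => approxErrTo N (σ d) (μ d) (α d) (b d) y k) atTop (𝓝 (q y k))) →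
        (∀ y k, k ≠ y →
          TendstoInProb (fun d => trainLaw N (σ d) (μ d))
            (fun d X => errTo (σ d) (μ d) (weights (α d) X) (b d) y k) (fun _ => q y k)) ∧
        ∀ l : ℝ,
          TendstoInProb (fun d => trainLaw N (σ d) (μ d))
            (fun d X => worstClassErr (σ d) (μ d) (weights (α d) X) (b d)) (fun _ => l) →
          maxPairs q ≤ l) := by
  refine ⟨fun d hd y => ⟨fun i => ⟨integrable_scoreMean N (σ d) (μ d) (α d) (b d) y i,
      expScoreMean_apply (α d) (b d) y hd.orthogonal i⟩,
    fun i j => ⟨integrable_scoreCov N (σ d) (μ d) (α d) y i j,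
      expScoreCov_apply (α d) y hN hd.orthogonal i j⟩⟩,
    fun y => ⟨tendstoInProb_err hN hscale α b y,
      fun l => (tendstoInProb_err hN hscale α b y).const_of_tendsto⟩,
    tendstoInProb_worstClassErr hN hscale α b,
    fun y k _ => tendstoInProb_errTo hN hscale α b,
    fun hα => ?_⟩
  have h_errTo (y k : Fin c) (hk : k ≠ y) := tendstoInProb_errTo hN hscale α b (hα y k hk)
  refine ⟨fun ε => (TendstoInProb.maxPairs h_errTo).tendsto_measure_lt_sub fun d X =>
    maxPairs_errTo_le_worstClassErr (σ d) (μ d) (weights (α d) X) (b d), fun q hq => ?_⟩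
  have h_lim (y k : Fin c) (hk : k ≠ y) := (h_errTo y k hk).const_of_tendsto (hq y k hk)
  exact ⟨h_lim, fun l hl => (TendstoInProb.maxPairs h_lim).le_of_le hl fun d X =>
    maxPairs_errTo_le_worstClassErr (σ d) (μ d) (weights (α d) X) (b d)⟩
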